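/- Lemma 3.3. A function $V \in L^1_{\mathrm{loc}}(\mathbb{R}^3)$ (real or complex valued) lies in the Kato class $\mathcal{K}_3$ if $$\lim_{r \to 0}\, \sup_{x \in \mathbb{R}^3} \int_{|x-y|<r} \frac{|V(y)|}{|x-y|}\,\mathrm{d}y = 0 .$$ Let $\mathcal{K}_3^c$ be the set of compactly supported elements of $\mathcal{K}_3$, and for $V \in \mathcal{K}_3^c$ let $$\|V\|_{\mathcal{K}_3} = \sup_{x \in \mathbb{R}^3} \int_{\mathbb{R}^3} \frac{|V(y)|}{|x-y|}\,\mathrm{d}y ,$$ which is finite. For $z \in \mathbb{C}^3$ with $z \cdot z = z_1^2+z_2^2+z_3^2 = 0$ let $\mathfrak{p}_z(\xi) = |\xi|^2 + 2 z \cdot \xi$ be the symbol of $-\Delta + 2 z \cdot D$, $D = -\mathrm{i}\nabla$, where $z\cdot\xi = z_1\xi_1+z_2\xi_2+z_3\xi_3$, and for a compactly supported $u \in L^1(\mathbb{R}^3)$ let $G_z u = \mathcal{F}^{-1}(\mathfrak{p}_z^{-1} \mathcal{F} u)$, a tempered distribution on $\mathbb{R}^3$. There is an absolute constant $C > 0$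 such that for all $V, W \in \mathcal{K}_3^c$, all $z \in \mathbb{C}^3$ with $z \cdot z = 0$ and all $f \in L^2(\mathbb{R}^3)$, the distribution $G_z(|W|^{1/2} f)$ is a locally integrable function, $|V|^{1/2} G_z (|W|^{1/2} f) \in L^2(\mathbb{R}^3)$, and $$\big\| |V|^{1/2} G_z |W|^{1/2} f \big\|_{L^2(\mathbb{R}^3)} \le C\, \|V\|_{\mathcal{K}_3}^{1/2}\, \|W\|_{\mathcal{K}_3}^{1/2}\, \|f\|_{L^2(\mathbb{R}^3)} .$$ -/

import Mathlib

open MeasureTheory Filter Topology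
open scoped FourierTransform SchwartzMap ENNReal

noncomputable section

namespace KatoCGO

/-- Euclidean three-space. -/
abbrev E3 : Type := EuclideanSpace ℝ (Fin 3)

/-- The Kato class `𝒦₃`: locally integrable `V` with
`lim_{r → 0} sup_x ∫_{|x - y| < r} |V(y)| / |x - y| dy = 0`.
The integrals and the supremum are taken in `[0, ∞]`. -/
structure IsKato (V : E3 → ℂ) : Prop where
  locallyIntegrable : LocallyIntegrable V volume
  tendsto_zero :
    Tendsto (fun r : ℝ => ⨆ x : E3, ∫⁻ y in Metric.ball x r, ‖V y‖ₑ / ‖x - y‖ₑ ∂volume)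
      (𝓝[>] 0) (𝓝 0)

/-- The class `𝒦₃ᶜ` of Kato functions with compact (essential) support. -/
structure IsKatoCompact (V : E3 → ℂ) : Prop where
  isKato : IsKato V
  compactSupport : ∃ K : Set E3, IsCompact K ∧ ∀ᵐ x ∂(volume : Measure E3), x ∉ K → V x = 0

/-- The global Kato norm `sup_x ∫ |V(y)| / |x - y| dy` as an element of `[0, ∞]`. -/
def eKatoNorm (V : E3 → ℂ) : ℝ≥0∞ :=
  ⨆ x : E3, ∫⁻ y, ‖V y‖ₑ / ‖x - y‖ₑ ∂volume

/-- The global Kato norm as a real number (`eKatoNorm V` is finite on `𝒦₃ᶜ`,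
see `IsKatoCompact.eKatoNorm_lt_top`). -/
def katoNorm (V : E3 → ℂ) : ℝ := (eKatoNorm V).toReal

/-- The symbol `𝔭_z(ξ) = |ξ|² + 2 z · ξ` of `𝔭_z(D) = -Δ + 2 z · D`, `D = -i∇`. -/
def symbol (z : Fin 3 → ℂ) (ξ : E3) : ℂ :=
  ((‖ξ‖ ^ 2 : ℝ) : ℂ) + 2 * ∑ j, z j * ((ξ j : ℝ) : ℂ)

/-- The integrand of the pairing of `G_z u = 𝓕⁻¹ (𝔭_z⁻¹ 𝓕 u)` with a Schwartz function `φ`, that is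
of the pairing of `𝔭_z⁻¹ 𝓕 u` with `𝓕⁻¹ φ`. The Fourier transform of Mathlib is
`𝓕 u (η) = ∫ exp (-2πi x·η) u(x) dx`, so that `D = -i∇` acts on the Fourier side as multiplication
by `ξ = 2π η`, and `𝔭_z(D)` as multiplication by `𝔭_z(2π η)`. -/
def pairingIntegrand (z : Fin 3 → ℂ) (u : E3 → ℂ) (φ : 𝓢(E3, ℂ)) (η : E3) : ℂ :=
  (symbol z ((2 * Real.pi) • η))⁻¹ * 𝓕 u η * (𝓕⁻ φ : 𝓢(E3, ℂ)) η

/-- `IsGreen z u g`: for the integrable function `u`, the tempered distribution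
`G_z u = 𝓕⁻¹ (𝔭_z⁻¹ 𝓕 u)`, given by `φ ↦ ∫ 𝔭_z⁻¹ (𝓕 u) (𝓕⁻¹ φ)`,
is the locally integrable function `g`. This determines `g` up to a null set. -/
structure IsGreen (z : Fin 3 → ℂ) (u g : E3 → ℂ) : Prop where
  integrable : Integrable u volume
  integrable_pairing : ∀ φ : 𝓢(E3, ℂ), Integrable (pairingIntegrand z u φ) volume
  locallyIntegrable : LocallyIntegrable g volume
  integrable_mul : ∀ φ : 𝓢(E3, ℂ), Integrable (fun x => g x * φ x) volume
  pairing_eq : ∀ φ : 𝓢(E3, ℂ), ∫ x, g x * φ x = ∫ η, pairingIntegrand z u φ η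

/-- The function `|V|^{1/2}`. -/
def sqrtAbs (V : E3 → ℂ) (x : E3) : ℂ := ((Real.sqrt ‖V x‖ : ℝ) : ℂ)

theorem IsKatoCompact.integrable {V : E3 → ℂ} (hV : IsKatoCompact V) :
    Integrable V volume := by
  obtain ⟨K, hK, h0⟩ := hV.compactSupport
  have h1 : IntegrableOn V K volume := hV.isKato.locallyIntegrable.integrableOn_isCompact hK
  exact h1.integrable_of_ae_notMem_eq_zero h0

/-- The global Kato norm is finite on `𝒦₃ᶜ`. -/
theorem IsKatoCompact.eKatoNorm_lt_top {V : E3 → ℂ} (hV : IsKatoCompact V) :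
    eKatoNorm V < ∞ := by
  have h1 : ∀ᶠ r in 𝓝[>] (0 : ℝ),
      (⨆ x : E3, ∫⁻ y in Metric.ball x r, ‖V y‖ₑ / ‖x - y‖ₑ ∂volume) < 1 :=
    hV.isKato.tendsto_zero.eventually_lt_const one_pos
  obtain ⟨r, hr, hr0⟩ := (h1.and self_mem_nhdsWithin).exists
  have hr0 : 0 < r := hr0
  have hfin : (1 : ℝ≥0∞) + (∫⁻ y, ‖V y‖ₑ ∂volume) / ENNReal.ofReal r < ∞ := by
    refine ENNReal.add_lt_top.2 ⟨ENNReal.one_lt_top, ENNReal.div_lt_top ?_ ?_⟩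
    · exact hV.integrable.2.ne
    · simpa using hr0
  refine lt_of_le_of_lt (iSup_le fun x => ?_) hfin
  rw [← lintegral_add_compl _ (Metric.isOpen_ball (x := x) (ε := r)).measurableSet]
  refine add_le_add ?_ ?_
  · exact (le_iSup (fun x : E3 => ∫⁻ y in Metric.ball x r, ‖V y‖ₑ / ‖x - y‖ₑ ∂volume) x).trans hr.le
  · have h2 : ∫⁻ y in (Metric.ball x r)ᶜ, ‖V y‖ₑ / ‖x - y‖ₑ ∂volume
        ≤ ∫⁻ y in (Metric.ball x r)ᶜ, ‖V y‖ₑ / ENNReal.ofReal r ∂volume := by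
      refine setLIntegral_mono' (Metric.isOpen_ball.measurableSet.compl) fun y hy => ?_
      refine ENNReal.div_le_div_left ?_ _
      rw [← ofReal_norm]
      apply ENNReal.ofReal_le_ofReal
      have : r ≤ dist y x := by simpa using hy
      rwa [dist_comm, dist_eq_norm] at this
    refine h2.trans ((setLIntegral_le_lintegral _ _).trans ?_)
    simp only [div_eq_mul_inv]
    rw [lintegral_mul_const']
    simpa using hr0

end KatoCGO

end

/-!
The idea is that `G_z` is convolution with a kernel `k_z` satisfying `|k_z(x)| ≤ 4 / |x|`, uniformly
in `z`; the estimate is then Schur's test for the kernel `1 / |x - y|` with weights `|V|`, `|W|`.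

Since `z · z = 0`, the real and imaginary parts of `z` are orthogonal and have the same length `τ`.
Let `s` be the coordinate of `ξ` along `Im z` and `ζ` the transversal part of `ξ + Re z`, with length
`σ`. Then `𝔭_z(ξ) = (s + iτ)² + σ²` (`exists_frame`). By partial fractions, the inverse Fourier
transform of `1 / 𝔭_z` in `s` is `profile τ σ t / (2σ)`, where `t` is dual to `s` and the profile is
built from exponentials in `|t|` (`fourier_profile`). In polar coordinates for `ζ`, the transversal
transform leaves, up to a modulation and a constant, `∫ profile τ ρ t · 2π J₀(ρ r) dρ`, where `r` is
the length of the transversal part of `x`.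
For fixed `t` the profile is a combination of two exponentials in `ρ`, each monotone with values in
`[0, 1]` on an interval and of total mass at most `1 / |t|`. Hence the integral is `O(1 / |t|)`, and
because the primitive of `J₀` is bounded it is also `O(1 / r)` by integration by parts
(`norm_truncKernel_mul_le`). Together these give `O(1 / |x|)`. The primitive of `J₀` is bounded by
Bessel's equation in integrated form (`hasDerivAt_bessel_primitive`).

The integral over `(x, ζ)` does not converge absolutely, as the decay of the profile alone gives only
`1 / |t|`. The Fourier identity is therefore first proved for `|ζ| < R`
(`setIntegral_inv_coordSymbol_mul`) and then for `R → ∞` by dominated convergence, the kernel bound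
being uniform in `R` (`integral_inv_coordSymbol_mul_eq`). On the Fourier side, `1 / 𝔭_z` is
integrable against Schwartz functions because it is singular only on a circle
(`integrable_inv_coordSymbol_mul`).
-/

noncomputable section

namespace KatoCGO

/-! ### Bounded primitive of the Bessel function of order zero -/

/-- The phase of the plane wave with frequency `(p, q)` on the unit circle. -/
def phase (p q θ : ℝ) : ℝ := p * Real.cos θ + q * Real.sin θ

/-- The angular derivative of `phase p q`. -/
def phaseDeriv (p q θ : ℝ) : ℝ := -(p * Real.sin θ) + q * Real.cos θ

@[fun_prop]
lemma continuous_phase (p q : ℝ) : Continuous (phase p q) := by unfold phase; fun_prop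

@[fun_prop]
lemma continuous_phaseDeriv (p q : ℝ) : Continuous (phaseDeriv p q) := by
  unfold phaseDeriv; fun_prop

lemma hasDerivAt_phaseDeriv (p q θ : ℝ) : HasDerivAt (phaseDeriv p q) (-phase p q θ) θ := by
  unfold phaseDeriv phase
  exact ((((Real.hasDerivAt_sin θ).const_mul p).neg).add
    ((Real.hasDerivAt_cos θ).const_mul q)).congr_deriv (by ring)

lemma hasDerivAt_phase (p q θ : ℝ) : HasDerivAt (phase p q) (phaseDeriv p q θ) θ := by
  unfold phaseDeriv phase
  exact (((Real.hasDerivAt_cos θ).const_mul p).add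
    ((Real.hasDerivAt_sin θ).const_mul q)).congr_deriv (by ring)

lemma phase_sq_add_sq (p q θ : ℝ) : phase p q θ ^ 2 + phaseDeriv p q θ ^ 2 = p ^ 2 + q ^ 2 := by
  unfold phaseDeriv phase
  linear_combination (p ^ 2 + q ^ 2) * Real.sin_sq_add_cos_sq θ

lemma abs_phase_le (p q θ : ℝ) : |phase p q θ| ≤ √(p ^ 2 + q ^ 2) := by
  rw [← phase_sq_add_sq p q θ]
  exact Real.abs_le_sqrt (by nlinarith [sq_nonneg (phaseDeriv p q θ)])

/-- The angular moment `∫ g(θ) exp(iρ(p cos θ + q sin θ)) dθ` over the circle. -/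
def circleMoment (p q : ℝ) (g : ℝ → ℂ) (ρ : ℝ) : ℂ :=
  ∫ θ in (-Real.pi)..Real.pi, g θ * Complex.exp (Complex.I * (ρ * phase p q θ : ℝ))

lemma norm_exp_I_mul (x : ℝ) : ‖Complex.exp (Complex.I * (x : ℂ))‖ = 1 := by
  rw [mul_comm]; exact Complex.norm_exp_ofReal_mul_I x

lemma hasDerivAt_circleMoment (p q : ℝ) {g : ℝ → ℂ} (hg : Continuous g) (ρ : ℝ) :
    HasDerivAt (circleMoment p q g)
      (Complex.I * circleMoment p q (fun θ => phase p q θ * g θ) ρ) ρ := by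
  have key := (intervalIntegral.hasDerivAt_integral_of_dominated_loc_of_deriv_le
    (μ := volume) (a := -Real.pi) (b := Real.pi) (x₀ := ρ) (s := Set.univ)
    (F := fun ρ θ => g θ * Complex.exp (Complex.I * (ρ * phase p q θ : ℝ)))
    (F' := fun ρ θ => Complex.I * ((phase p q θ * g θ) *
      Complex.exp (Complex.I * (ρ * phase p q θ : ℝ))))
    (bound := fun θ => ‖phase p q θ * g θ‖) Filter.univ_mem
    (Filter.Eventually.of_forall fun x => by
      apply Continuous.aestronglyMeasurable; fun_prop)
    (by apply Continuous.intervalIntegrable; fun_prop)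
    (by apply Continuous.aestronglyMeasurable; fun_prop)
    (Filter.Eventually.of_forall fun θ _ x _ => by
      rw [norm_mul, norm_mul _ (Complex.exp _), norm_exp_I_mul]; simp)
    (by apply Continuous.intervalIntegrable; fun_prop)
    (Filter.Eventually.of_forall fun θ _ x _ => ?_)).2
  · unfold circleMoment
    rw [← intervalIntegral.integral_const_mul]
    exact key
  · have h1 : HasDerivAt (fun x : ℝ => Complex.I * ((x * phase p q θ : ℝ) : ℂ))
        (Complex.I * (phase p q θ : ℂ)) x := by
      have : HasDerivAt (fun x : ℝ => ((x * phase p q θ : ℝ) : ℂ)) (phase p q θ : ℂ) x := by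
        have := (hasDerivAt_mul_const (x := x) (phase p q θ)).ofReal_comp
        simpa using this
      exact this.const_mul _
    exact ((h1.cexp).const_mul (g θ)).congr_deriv (by ring)

lemma continuous_circleMoment (p q : ℝ) {g : ℝ → ℂ} (hg : Continuous g) :
    Continuous (circleMoment p q g) :=
  continuous_iff_continuousAt.2 fun ρ => (hasDerivAt_circleMoment p q hg ρ).continuousAt

lemma norm_circleMoment_le (p q : ℝ) {g : ℝ → ℂ} {M : ℝ} (hM : ∀ θ, ‖g θ‖ ≤ M) (ρ : ℝ) :
    ‖circleMoment p q g ρ‖ ≤ M * (2 * Real.pi) := by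
  have := intervalIntegral.norm_integral_le_of_norm_le_const (a := -Real.pi) (b := Real.pi)
    (f := fun θ => g θ * Complex.exp (Complex.I * (ρ * phase p q θ : ℝ))) (C := M)
    (fun θ _ => by rw [norm_mul, norm_exp_I_mul, mul_one]; exact hM θ)
  refine this.trans_eq ?_
  rw [sub_neg_eq_add, ← two_mul, abs_of_pos Real.two_pi_pos]

/-- `∫ exp(iρ(p cos θ + q sin θ)) dθ`, that is, `2π J₀(ρ √(p² + q²))`. -/
def circleWave (p q : ℝ) : ℝ → ℂ := circleMoment p q (fun _ => 1)

@[fun_prop]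
lemma continuous_circleWave (p q : ℝ) : Continuous (circleWave p q) :=
  continuous_circleMoment p q continuous_const

lemma norm_circleWave_le (p q ρ : ℝ) : ‖circleWave p q ρ‖ ≤ 2 * Real.pi := by
  simpa [circleWave] using norm_circleMoment_le p q (g := fun _ => 1) (M := 1) (by simp) ρ

/-- Integration by parts in the angle. Together with `hasDerivAt_circleMoment` this is Bessel's
equation. -/
lemma circleMoment_phase_eq (p q ρ : ℝ) :
    circleMoment p q (fun θ => (phase p q θ : ℂ)) ρ
      = Complex.I * ρ * circleMoment p q (fun θ => (phaseDeriv p q θ : ℂ) ^ 2) ρ := by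
  have hderiv : ∀ θ : ℝ, HasDerivAt
      (fun θ => (phaseDeriv p q θ : ℂ) * Complex.exp (Complex.I * (ρ * phase p q θ : ℝ)))
      (-(phase p q θ * Complex.exp (Complex.I * (ρ * phase p q θ : ℝ)))
        + Complex.I * ρ * ((phaseDeriv p q θ : ℂ) ^ 2 *
          Complex.exp (Complex.I * (ρ * phase p q θ : ℝ)))) θ := by
    intro θ
    have h1 := (hasDerivAt_phaseDeriv p q θ).ofReal_comp
    have h2 := ((((hasDerivAt_phase p q θ).const_mul ρ).ofReal_comp).const_mul Complex.I).cexp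
    refine (h1.mul h2).congr_deriv ?_
    push_cast
    ring
  have hF := intervalIntegral.integral_eq_sub_of_hasDerivAt (a := -Real.pi) (b := Real.pi)
    (fun θ _ => hderiv θ) (by apply Continuous.intervalIntegrable; fun_prop)
  have hper : (phaseDeriv p q Real.pi : ℂ) * Complex.exp (Complex.I * (ρ * phase p q Real.pi : ℝ))
      - (phaseDeriv p q (-Real.pi) : ℂ)
        * Complex.exp (Complex.I * (ρ * phase p q (-Real.pi) : ℝ)) = 0 := by
    simp [phase, phaseDeriv]
  rw [hper, intervalIntegral.integral_add (by apply Continuous.intervalIntegrable; fun_prop)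
    (by apply Continuous.intervalIntegrable; fun_prop), intervalIntegral.integral_neg,
    intervalIntegral.integral_const_mul] at hF
  unfold circleMoment
  linear_combination -hF

/-- Bessel's equation in integrated form: the derivative of `-i B - A / ρ` is `r² A + A / ρ²`, where
`A = circleWave p q`, `B` is the first moment and `r² = p² + q²`. -/
lemma hasDerivAt_bessel_primitive (p q : ℝ) {ρ : ℝ} (hρ : 0 < ρ) :
    HasDerivAt (fun ρ : ℝ => -Complex.I * circleMoment p q (fun θ => (phase p q θ : ℂ)) ρ
        - circleWave p q ρ / ρ)
      (((p ^ 2 + q ^ 2 : ℝ) : ℂ) * circleWave p q ρ + circleWave p q ρ / ρ ^ 2) ρ := by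
  have hρ' : (ρ : ℂ) ≠ 0 := by exact_mod_cast hρ.ne'
  have hA := hasDerivAt_circleMoment p q (g := fun _ => 1) continuous_const ρ
  have hB := hasDerivAt_circleMoment p q (g := fun θ => (phase p q θ : ℂ)) (by fun_prop) ρ
  have hid : HasDerivAt (fun ρ : ℝ => (ρ : ℂ)) 1 ρ := by
    simpa using (hasDerivAt_id ρ).ofReal_comp
  have h := (hB.const_mul (-Complex.I)).sub (hA.div hid hρ')
  have hsq : circleMoment p q (fun θ => (phase p q θ : ℂ) * (phase p q θ : ℂ)) ρ
      = ((p ^ 2 + q ^ 2 : ℝ) : ℂ) * circleWave p q ρ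
        - circleMoment p q (fun θ => (phaseDeriv p q θ : ℂ) ^ 2) ρ := by
    unfold circleWave circleMoment
    rw [← intervalIntegral.integral_const_mul, ← intervalIntegral.integral_sub
      (by apply Continuous.intervalIntegrable; fun_prop)
      (by apply Continuous.intervalIntegrable; fun_prop)]
    congr 1; ext θ
    have := congrArg (fun x : ℝ => (x : ℂ)) (phase_sq_add_sq p q θ)
    push_cast at this ⊢
    linear_combination
      Complex.exp (Complex.I * ((ρ : ℂ) * (phase p q θ : ℂ))) * this
  refine h.congr_deriv ?_
  rw [hsq]
  have h1 := circleMoment_phase_eq p q ρ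
  simp only [mul_one]
  rw [h1]
  change _ - (Complex.I * (Complex.I * ρ * _) * ρ - circleWave p q ρ) / (ρ : ℂ) ^ 2 = _
  field_simp
  linear_combination (-(ρ : ℂ) ^ 2 * ((p ^ 2 + q ^ 2 : ℝ) : ℂ) * circleWave p q ρ) * Complex.I_sq

/-- The primitive of the Bessel function `J₀` is bounded, in scaled form. -/
lemma norm_integral_circleWave_mul_le (p q : ℝ) {s : ℝ} (hs : 0 ≤ s) :
    ‖∫ ρ in (0 : ℝ)..s, circleWave p q ρ‖ * √(p ^ 2 + q ^ 2) ≤ 12 * Real.pi := by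
  set r := √(p ^ 2 + q ^ 2) with hr
  have hpi := Real.pi_pos
  rcases (Real.sqrt_nonneg (p ^ 2 + q ^ 2)).eq_or_lt with h0 | h0
  · rw [← hr] at h0
    rw [← h0]; simp; positivity
  rw [← hr] at h0
  have hr2 : p ^ 2 + q ^ 2 = r ^ 2 := by rw [hr, Real.sq_sqrt (by positivity)]
  -- Up to `ρ = 1 / r` the trivial bound on the integrand suffices; beyond it Bessel's equation is
  -- integrated.
  have hsmall : ∀ t : ℝ, 0 ≤ t → t ≤ 1 / r →
      ‖∫ ρ in (0 : ℝ)..t, circleWave p q ρ‖ * r ≤ 2 * Real.pi := by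
    intro t ht htr
    have := intervalIntegral.norm_integral_le_of_norm_le_const (a := 0) (b := t)
      (f := circleWave p q) (fun ρ _ => norm_circleWave_le p q ρ)
    rw [sub_zero, abs_of_nonneg ht] at this
    have h2 : t * r ≤ 1 := by rwa [le_div_iff₀ h0] at htr
    nlinarith
  rcases le_total s (1 / r) with h | h
  · linarith [hsmall s hs h]
  have hr1 : 0 < 1 / r := by positivity
  have hpos : ∀ ρ ∈ Set.uIcc (1 / r) s, 0 < ρ := by
    intro ρ hρ
    rw [Set.uIcc_of_le h] at hρ
    exact hr1.trans_le hρ.1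
  have hint2 : IntervalIntegrable (fun ρ : ℝ => circleWave p q ρ / (ρ : ℂ) ^ 2) volume (1 / r) s := by
    apply ContinuousOn.intervalIntegrable
    apply ContinuousOn.div (by fun_prop) (by fun_prop)
    intro ρ hρ
    have := (hpos ρ hρ).ne'
    simpa using this
  have hF := intervalIntegral.integral_eq_sub_of_hasDerivAt (a := 1 / r) (b := s)
    (fun ρ hρ => hasDerivAt_bessel_primitive p q (hpos ρ hρ))
    (IntervalIntegrable.add (by apply Continuous.intervalIntegrable; fun_prop) hint2)
  rw [intervalIntegral.integral_add (by apply Continuous.intervalIntegrable; fun_prop) hint2,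
    intervalIntegral.integral_const_mul] at hF
  have hbd : ∀ ρ : ℝ, 1 / r ≤ ρ → ‖-Complex.I * circleMoment p q (fun θ => (phase p q θ : ℂ)) ρ
        - circleWave p q ρ / ρ‖ ≤ 4 * Real.pi * r := by
    intro ρ hρ
    have hρ0 : 0 < ρ := hr1.trans_le hρ
    refine (norm_sub_le _ _).trans ?_
    have h1 : ‖-Complex.I * circleMoment p q (fun θ => (phase p q θ : ℂ)) ρ‖ ≤ r * (2 * Real.pi) := by
      rw [norm_mul]; simp only [norm_neg, Complex.norm_I, one_mul]
      exact norm_circleMoment_le p q (fun θ => by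
        rw [Complex.norm_real]; exact abs_phase_le p q θ) ρ
    have h2 : ‖circleWave p q ρ / ρ‖ ≤ r * (2 * Real.pi) := by
      rw [norm_div, Complex.norm_real, Real.norm_of_nonneg hρ0.le, div_le_iff₀ hρ0]
      have : 1 ≤ ρ * r := by rwa [div_le_iff₀ h0] at hρ
      have := norm_circleWave_le p q ρ
      nlinarith
    linarith
  have hrest : ‖∫ ρ in (1 / r)..s, circleWave p q ρ / (ρ : ℂ) ^ 2‖ ≤ 2 * Real.pi * r := by
    have hle := intervalIntegral.norm_integral_le_of_norm_le (a := 1 / r) (b := s) (μ := volume)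
      (f := fun ρ : ℝ => circleWave p q ρ / (ρ : ℂ) ^ 2)
      (g := fun ρ : ℝ => 2 * Real.pi * ρ ^ (-2 : ℤ)) h
      (Filter.Eventually.of_forall fun ρ hρ => by
        have : 0 < ρ := hr1.trans hρ.1
        rw [norm_div, norm_pow, Complex.norm_real, Real.norm_of_nonneg this.le, zpow_neg,
          div_eq_mul_inv]
        gcongr
        · exact norm_circleWave_le p q ρ
        · rfl) ?_
    · refine hle.trans ?_
      rw [intervalIntegral.integral_const_mul, integral_zpow (Or.inr ⟨by norm_num, ?_⟩)]
      · gcongr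
        norm_num
        have : 0 < s := hr1.trans_le h
        rw [show ((s⁻¹ - r) / -1 : ℝ) = r - s⁻¹ by ring]
        have := inv_pos.2 this
        linarith
      · intro hmem
        exact lt_irrefl _ (hpos 0 hmem)
    · apply IntervalIntegrable.const_mul
      apply intervalIntegral.intervalIntegrable_zpow
      right; intro hmem
      exact lt_irrefl _ (hpos 0 hmem)
  have hlarge : ‖∫ ρ in (1 / r)..s, circleWave p q ρ‖ * r ≤ 10 * Real.pi := by
    have heq : ((p ^ 2 + q ^ 2 : ℝ) : ℂ) * ∫ ρ in (1 / r)..s, circleWave p q ρ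
        = (-Complex.I * circleMoment p q (fun θ => (phase p q θ : ℂ)) s - circleWave p q s / s)
          - (-Complex.I * circleMoment p q (fun θ => (phase p q θ : ℂ)) (1 / r : ℝ)
            - circleWave p q (1 / r) / (1 / r : ℝ))
          - ∫ ρ in (1 / r)..s, circleWave p q ρ / (ρ : ℂ) ^ 2 := by
      rw [← hF]; ring
    have hn := congrArg norm heq
    rw [norm_mul, Complex.norm_real, hr2, Real.norm_of_nonneg (by positivity)] at hn
    have := (norm_sub_le ((-Complex.I * circleMoment p q (fun θ => (phase p q θ : ℂ)) s
          - circleWave p q s / s)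
          - (-Complex.I * circleMoment p q (fun θ => (phase p q θ : ℂ)) (1 / r : ℝ)
            - circleWave p q (1 / r) / (1 / r : ℝ)))
          (∫ ρ in (1 / r)..s, circleWave p q ρ / (ρ : ℂ) ^ 2)).trans
        (add_le_add ((norm_sub_le _ _).trans (add_le_add (hbd s h) (hbd (1 / r) le_rfl))) hrest)
    rw [← hn] at this
    have h3 : r * (‖∫ ρ in (1 / r)..s, circleWave p q ρ‖ * r) ≤ r * (10 * Real.pi) := by
      nlinarith
    exact le_of_mul_le_mul_left h3 h0
  rw [← intervalIntegral.integral_add_adjacent_intervals (b := 1 / r)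
    (by apply Continuous.intervalIntegrable; fun_prop)
    (by apply Continuous.intervalIntegrable; fun_prop)]
  calc _ ≤ (‖∫ ρ in (0 : ℝ)..(1 / r), circleWave p q ρ‖
        + ‖∫ ρ in (1 / r)..s, circleWave p q ρ‖) * r := by gcongr; exact norm_add_le _ _
    _ ≤ _ := by linarith [hsmall (1 / r) hr1.le le_rfl]

/-- The primitive of an exponential weight with values in `[0, 1]`. -/
lemma abs_mul_integral_exp_le {s α β γ : ℝ} (hα : 0 ≤ s * (α - γ)) (hβ : 0 ≤ s * (β - γ)) :
    |s| * |∫ ρ in α..β, Real.exp (-(s * (ρ - γ)))| ≤ 1 := by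
  have hd : ∀ ρ : ℝ, HasDerivAt (fun ρ => -Real.exp (-(s * (ρ - γ))))
      (s * Real.exp (-(s * (ρ - γ)))) ρ := by
    intro ρ
    have h1 : HasDerivAt (fun ρ : ℝ => -(s * (ρ - γ))) (-s) ρ := by
      exact ((((hasDerivAt_id ρ).sub_const γ).const_mul s).neg).congr_deriv (by ring)
    exact h1.exp.neg.congr_deriv (by ring)
  have := intervalIntegral.integral_eq_sub_of_hasDerivAt (a := α) (b := β) (fun ρ _ => hd ρ)
    (by apply Continuous.intervalIntegrable; fun_prop)
  rw [intervalIntegral.integral_const_mul] at this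
  rw [← abs_mul, this, abs_le]
  have h1 := Real.exp_pos (-(s * (β - γ)))
  have h2 := Real.exp_pos (-(s * (α - γ)))
  have h3 := Real.exp_le_one_iff.2 (neg_nonpos.2 hα)
  have h4 := Real.exp_le_one_iff.2 (neg_nonpos.2 hβ)
  constructor <;> linarith

lemma norm_integral_exp_mul_circleWave_mul_abs_le (p q : ℝ) {s α β γ : ℝ} (hαβ : α ≤ β)
    (hα : 0 ≤ s * (α - γ)) (hβ : 0 ≤ s * (β - γ)) :
    ‖∫ ρ in α..β, (Real.exp (-(s * (ρ - γ))) : ℂ) * circleWave p q ρ‖ * |s| ≤ 2 * Real.pi := by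
  have h1 := intervalIntegral.norm_integral_le_of_norm_le (a := α) (b := β) (μ := volume)
    (f := fun ρ => (Real.exp (-(s * (ρ - γ))) : ℂ) * circleWave p q ρ)
    (g := fun ρ => Real.exp (-(s * (ρ - γ))) * (2 * Real.pi)) hαβ
    (Filter.Eventually.of_forall fun ρ _ => by
      rw [norm_mul, Complex.norm_real, Real.norm_of_nonneg (Real.exp_pos _).le]
      gcongr
      exact norm_circleWave_le p q ρ)
    (by apply Continuous.intervalIntegrable; fun_prop)
  rw [intervalIntegral.integral_mul_const] at h1
  have h2 := abs_mul_integral_exp_le hα hβ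
  have h3 := le_abs_self (∫ ρ in α..β, Real.exp (-(s * (ρ - γ))))
  have hpi := Real.pi_pos
  calc _ ≤ (|∫ ρ in α..β, Real.exp (-(s * (ρ - γ)))| * (2 * Real.pi)) * |s| := by
        gcongr; exact h1.trans (by gcongr)
    _ = (|s| * |∫ ρ in α..β, Real.exp (-(s * (ρ - γ)))|) * (2 * Real.pi) := by ring
    _ ≤ 1 * (2 * Real.pi) := by gcongr
    _ = _ := one_mul _

/-- A monotone weight with values in `[0, 1]` does not spoil the decay of the primitive of `J₀`
(second mean value theorem). -/
lemma norm_integral_exp_mul_circleWave_mul_sqrt_le (p q : ℝ) {s α β γ : ℝ} (h0α : 0 ≤ α)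
    (hαβ : α ≤ β) (hα : 0 ≤ s * (α - γ)) (hβ : 0 ≤ s * (β - γ)) :
    ‖∫ ρ in α..β, (Real.exp (-(s * (ρ - γ))) : ℂ) * circleWave p q ρ‖ * √(p ^ 2 + q ^ 2)
      ≤ 36 * Real.pi := by
  set r := √(p ^ 2 + q ^ 2) with hr
  have hpi := Real.pi_pos
  have hr0 : 0 ≤ r := Real.sqrt_nonneg _
  let P : ℝ → ℂ := fun x => ∫ ρ in (0 : ℝ)..x, circleWave p q ρ
  have hP : ∀ x, HasDerivAt P (circleWave p q x) x := fun x =>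
    intervalIntegral.integral_hasDerivAt_right
      (by apply Continuous.intervalIntegrable; fun_prop)
      (Continuous.stronglyMeasurableAtFilter (by fun_prop) _ _)
      (by fun_prop : Continuous (circleWave p q)).continuousAt
  have hPb : ∀ x, 0 ≤ x → ‖P x‖ * r ≤ 12 * Real.pi := fun x hx =>
    norm_integral_circleWave_mul_le p q hx
  have hPc : Continuous P := continuous_iff_continuousAt.2 fun x => (hP x).continuousAt
  have hm : ∀ ρ : ℝ, HasDerivAt (fun ρ : ℝ => (Real.exp (-(s * (ρ - γ))) : ℂ))
      ((-s * Real.exp (-(s * (ρ - γ))) : ℝ) : ℂ) ρ := by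
    intro ρ
    have h1 : HasDerivAt (fun ρ : ℝ => -(s * (ρ - γ))) (-s) ρ := by
      exact ((((hasDerivAt_id ρ).sub_const γ).const_mul s).neg).congr_deriv (by ring)
    refine h1.exp.ofReal_comp.congr_deriv ?_
    push_cast
    ring
  have hibp := intervalIntegral.integral_mul_deriv_eq_deriv_mul (a := α) (b := β)
    (fun ρ _ => hm ρ) (fun ρ _ => hP ρ)
    (by apply Continuous.intervalIntegrable; fun_prop)
    (by apply Continuous.intervalIntegrable; fun_prop)
  rw [hibp]
  have hend : ∀ x, 0 ≤ x → 0 ≤ s * (x - γ) →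
      ‖(Real.exp (-(s * (x - γ))) : ℂ) * P x‖ * r ≤ 12 * Real.pi := by
    intro x hx hsx
    rw [norm_mul, Complex.norm_real, Real.norm_of_nonneg (Real.exp_pos _).le]
    have h1 := Real.exp_le_one_iff.2 (neg_nonpos.2 hsx)
    have h2 := hPb x hx
    have h3 : 0 ≤ ‖P x‖ * r := by positivity
    have h4 := Real.exp_pos (-(s * (x - γ)))
    nlinarith
  have hrem : ‖∫ ρ in α..β, ((-s * Real.exp (-(s * (ρ - γ))) : ℝ) : ℂ) * P ρ‖ * r
      ≤ 12 * Real.pi := by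
    have h1 := intervalIntegral.norm_integral_le_of_norm_le (a := α) (b := β) (μ := volume)
      (f := fun ρ => (((-s * Real.exp (-(s * (ρ - γ))) : ℝ) : ℂ) * P ρ) * (r : ℂ))
      (g := fun ρ => |s| * Real.exp (-(s * (ρ - γ))) * (12 * Real.pi)) hαβ
      (Filter.Eventually.of_forall fun ρ hρ => by
        have hρ0 : 0 ≤ ρ := h0α.trans hρ.1.le
        rw [norm_mul, norm_mul, Complex.norm_real, Complex.norm_real, norm_mul, norm_neg,
          Real.norm_of_nonneg (Real.exp_pos _).le, Real.norm_eq_abs, Real.norm_of_nonneg hr0,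
          mul_assoc]
        exact mul_le_mul_of_nonneg_left (hPb ρ hρ0) (by positivity))
      (by apply Continuous.intervalIntegrable; fun_prop)
    rw [intervalIntegral.integral_mul_const, intervalIntegral.integral_mul_const,
      intervalIntegral.integral_const_mul, norm_mul, Complex.norm_real,
      Real.norm_of_nonneg hr0] at h1
    refine h1.trans ?_
    have h2 := abs_mul_integral_exp_le hα hβ
    have h3 := le_abs_self (∫ ρ in α..β, Real.exp (-(s * (ρ - γ))))
    have : |s| * ∫ ρ in α..β, Real.exp (-(s * (ρ - γ))) ≤ 1 :=
      (mul_le_mul_of_nonneg_left h3 (abs_nonneg s)).trans h2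
    nlinarith
  have hA := hend β (h0α.trans hαβ) hβ
  have hB := hend α h0α hα
  calc _ ≤ (‖(Real.exp (-(s * (β - γ))) : ℂ) * P β‖ + ‖(Real.exp (-(s * (α - γ))) : ℂ) * P α‖
        + ‖∫ ρ in α..β, ((-s * Real.exp (-(s * (ρ - γ))) : ℝ) : ℂ) * P ρ‖) * r := by
        gcongr
        exact (norm_sub_le _ _).trans (by gcongr; exact norm_sub_le _ _)
    _ ≤ _ := by linarith

/-! ### The symbol along the direction of the imaginary part -/

/-- The symbol in adapted coordinates: `s` is the coordinate along `Im z`, `σ` the distance of the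
transversal variable to its centre, and `τ = |Im z|`. -/
def radialSymbol (τ σ s : ℝ) : ℂ := ((s : ℂ) + Complex.I * τ) ^ 2 + (σ : ℂ) ^ 2

lemma radialSymbol_eq_mul (τ σ s : ℝ) :
    radialSymbol τ σ s
      = (((σ - τ : ℝ) : ℂ) + (s : ℝ) * Complex.I) * (((σ + τ : ℝ) : ℂ) + ((-s : ℝ) : ℂ) * Complex.I) := by
  unfold radialSymbol
  push_cast
  linear_combination ((τ : ℂ) ^ 2 + (s : ℂ) ^ 2) * Complex.I_sq

lemma norm_radialSymbol_sq (τ σ s : ℝ) :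
    ‖radialSymbol τ σ s‖ ^ 2 = ((σ - τ) ^ 2 + s ^ 2) * ((σ + τ) ^ 2 + s ^ 2) := by
  rw [radialSymbol_eq_mul, norm_mul, mul_pow, ← Complex.normSq_eq_norm_sq,
    ← Complex.normSq_eq_norm_sq, Complex.normSq_add_mul_I, Complex.normSq_add_mul_I, neg_sq]

lemma sq_add_sq_le_norm_radialSymbol {τ σ : ℝ} (hτ : 0 ≤ τ) (hσ : 0 ≤ σ) (s : ℝ) :
    (σ - τ) ^ 2 + s ^ 2 ≤ ‖radialSymbol τ σ s‖ := by
  refine le_of_sq_le_sq ?_ (norm_nonneg _)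
  rw [norm_radialSymbol_sq, sq]
  have : 0 ≤ σ * τ := mul_nonneg hσ hτ
  gcongr ?_ * ?_
  nlinarith

lemma radialSymbol_ne_zero {τ σ : ℝ} (hτ : 0 ≤ τ) (hσ : 0 ≤ σ) (h : σ ≠ τ) (s : ℝ) :
    radialSymbol τ σ s ≠ 0 := by
  have h1 := sq_add_sq_le_norm_radialSymbol hτ hσ s
  have h2 : 0 < (σ - τ) ^ 2 := by have := sub_ne_zero.2 h; positivity
  intro h0
  rw [h0, norm_zero] at h1
  nlinarith [sq_nonneg s]

/-- This lower bound separates the variables, which makes the local integrability of the inverse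
of the symbol visible. -/
lemma mul_sqrt_le_norm_radialSymbol {τ σ : ℝ} (hτ : 0 ≤ τ) (hσ : 0 ≤ σ) (s : ℝ) :
    σ * (√|σ - τ| * √|s|) ≤ ‖radialSymbol τ σ s‖ := by
  refine le_of_sq_le_sq ?_ (norm_nonneg _)
  rw [norm_radialSymbol_sq, mul_pow, mul_pow, Real.sq_sqrt (abs_nonneg _),
    Real.sq_sqrt (abs_nonneg _), mul_comm]
  have h1 : |σ - τ| * |s| ≤ (σ - τ) ^ 2 + s ^ 2 := by
    rw [← sq_abs (σ - τ), ← sq_abs s]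
    nlinarith [sq_nonneg (|σ - τ| - |s|), abs_nonneg (σ - τ), abs_nonneg s]
  have h2 : σ ^ 2 ≤ (σ + τ) ^ 2 + s ^ 2 := by nlinarith [sq_nonneg s, mul_nonneg hσ hτ]
  gcongr

/-- Up to the factor `2σ`, the inverse Fourier transform in the direction of `Im z` of the inverse
of the symbol. -/
def profile (τ σ t : ℝ) : ℝ :=
  if 0 ≤ t then (if τ < σ then Real.exp (-(t * (σ - τ))) else 0)
  else Real.exp (t * (σ + τ)) - (if σ < τ then Real.exp (t * (τ - σ)) else 0)

lemma measurable_profile (τ : ℝ) : Measurable (fun x : ℝ × ℝ => profile τ x.1 x.2) := by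
  unfold profile
  refine Measurable.ite (measurableSet_le measurable_const measurable_snd)
    (Measurable.ite (measurableSet_lt measurable_const measurable_fst) (by fun_prop)
      measurable_const)
    (Measurable.sub (by fun_prop) (Measurable.ite
      (measurableSet_lt measurable_fst measurable_const) (by fun_prop) measurable_const))

lemma abs_profile_le {τ σ : ℝ} (hτ : 0 ≤ τ) (hσ : 0 ≤ σ) (t : ℝ) :
    |profile τ σ t| ≤ Real.exp (-(|t| * |σ - τ|)) := by
  unfold profile
  split_ifs with h1 h2 h2
  · rw [abs_of_pos (Real.exp_pos _), abs_of_nonneg h1, abs_of_pos (sub_pos.2 h2)]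
  · rw [abs_zero]; exact (Real.exp_pos _).le
  · have h1' : t < 0 := not_le.1 h1
    rw [abs_of_neg h1', abs_of_neg (sub_neg.2 h2)]
    have ha : Real.exp (t * (σ + τ)) ≤ Real.exp (t * (τ - σ)) := by
      apply Real.exp_le_exp.2; nlinarith
    rw [abs_of_nonpos (sub_nonpos.2 ha)]
    have hb := Real.exp_pos (t * (σ + τ))
    have : -(-t * -(σ - τ)) = t * (τ - σ) := by ring
    rw [this]; linarith
  · have h1' : t < 0 := not_le.1 h1
    rw [sub_zero, abs_of_pos (Real.exp_pos _), abs_of_neg h1',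
      abs_of_nonneg (sub_nonneg.2 (not_lt.1 h2))]
    apply Real.exp_le_exp.2
    nlinarith

lemma abs_profile_le_one {τ σ : ℝ} (hτ : 0 ≤ τ) (hσ : 0 ≤ σ) (t : ℝ) : |profile τ σ t| ≤ 1 :=
  (abs_profile_le hτ hσ t).trans (Real.exp_le_one_iff.2 (neg_nonpos.2 (by positivity)))

lemma continuous_profile {τ σ : ℝ} (h : σ ≠ τ) : Continuous (profile τ σ) := by
  unfold profile
  rcases lt_or_gt_of_ne h with h | h
  · simp only [h, if_true, not_lt.2 h.le, if_false]
    refine Continuous.if_le (by fun_prop) (by fun_prop) continuous_const continuous_id ?_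
    intro t ht; simp [← ht]
  · simp only [h, if_true, not_lt.2 h.le, if_false]
    refine Continuous.if_le (by fun_prop) (by fun_prop) continuous_const continuous_id ?_
    intro t ht; simp [← ht]

lemma integrable_exp_neg_mul_abs {c : ℝ} (hc : 0 < c) :
    Integrable (fun t : ℝ => Real.exp (-(|t| * c))) := by
  -- The bound used is `1 + (|t| c / 2)² ≤ exp (|t| c)`.
  have h0 := (integrable_inv_one_add_sq.comp_mul_left' (R := c / 2) (by positivity))
  refine h0.mono' (Continuous.aestronglyMeasurable (by fun_prop))
    (Eventually.of_forall fun t => ?_)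
  rw [Real.norm_of_nonneg (Real.exp_pos _).le, Real.exp_neg]
  refine inv_anti₀ (by positivity) ?_
  have hx : 0 ≤ |t| * c := by positivity
  have := Real.quadratic_le_exp_of_nonneg hx
  rw [show (c / 2 * t) ^ 2 = (|t| * c) ^ 2 / 4 by rw [mul_pow |t|, sq_abs]; ring]
  nlinarith [sq_nonneg (|t| * c)]

lemma integrable_profile {τ σ : ℝ} (hτ : 0 ≤ τ) (hσ : 0 ≤ σ) (h : σ ≠ τ) :
    Integrable (profile τ σ) :=
  (integrable_exp_neg_mul_abs (abs_pos.2 (sub_ne_zero.2 h))).mono'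
    (continuous_profile h).aestronglyMeasurable
    (Eventually.of_forall fun t => abs_profile_le hτ hσ t)

lemma continuous_inv_radialSymbol {τ σ : ℝ} (hτ : 0 ≤ τ) (hσ : 0 ≤ σ) (h : σ ≠ τ) :
    Continuous (fun η : ℝ => (radialSymbol τ σ (2 * Real.pi * η))⁻¹) := by
  refine Continuous.inv₀ ?_ fun η => radialSymbol_ne_zero hτ hσ h _
  unfold radialSymbol
  fun_prop

lemma integrable_inv_radialSymbol {τ σ : ℝ} (hτ : 0 ≤ τ) (hσ : 0 ≤ σ) (h : σ ≠ τ) :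
    Integrable (fun η : ℝ => (radialSymbol τ σ (2 * Real.pi * η))⁻¹) := by
  have hd : σ - τ ≠ 0 := sub_ne_zero.2 h
  have hd2 : 0 < (σ - τ) ^ 2 := by positivity
  have h0 := (integrable_inv_one_add_sq.comp_mul_left' (R := 2 * Real.pi / |σ - τ|)
    (by have := Real.pi_pos; positivity)).const_mul ((σ - τ) ^ 2)⁻¹
  refine h0.mono' (continuous_inv_radialSymbol hτ hσ h).aestronglyMeasurable
    (Eventually.of_forall fun η => ?_)
  rw [norm_inv, ← mul_inv]
  refine inv_anti₀ (by positivity) (le_trans (le_of_eq ?_)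
    (sq_add_sq_le_norm_radialSymbol hτ hσ (2 * Real.pi * η)))
  have : |σ - τ| ≠ 0 := by positivity
  rw [mul_pow (2 * Real.pi / |σ - τ|), div_pow, sq_abs]
  field_simp

/-- The one-dimensional Fourier transform of the profile. It follows from the partial fraction
decomposition `2σ / ((s + iτ)² + σ²) = 1 / (σ - τ + is) + 1 / (σ + τ - is)`. -/
lemma fourier_profile {τ σ : ℝ} (hτ : 0 ≤ τ) (hσ : 0 < σ) (h : σ ≠ τ) (η : ℝ) :
    𝓕 (fun t : ℝ => ((profile τ σ t / (2 * σ) : ℝ) : ℂ)) η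
      = (radialSymbol τ σ (2 * Real.pi * η))⁻¹ := by
  have hint : Integrable (fun t : ℝ => Complex.exp (((-2 * Real.pi * t * η : ℝ) : ℂ) * Complex.I) *
      ((profile τ σ t : ℝ) : ℂ)) :=
    (integrable_profile hτ hσ.le h).ofReal.bdd_mul (c := 1)
      (Continuous.aestronglyMeasurable (by fun_prop))
      (Eventually.of_forall fun t => (Complex.norm_exp_ofReal_mul_I _).le)
  set s := 2 * Real.pi * η with hs
  have hσ' : (σ : ℂ) ≠ 0 := by exact_mod_cast hσ.ne'
  have hne := radialSymbol_ne_zero hτ hσ.le h s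
  have hf := radialSymbol_eq_mul τ σ s
  rw [hf] at hne
  have hne1 := left_ne_zero_of_mul hne
  have hne2 := right_ne_zero_of_mul hne
  have hneg : ∫ t in Set.Iic (0 : ℝ), Complex.exp (((σ + τ : ℝ) : ℂ) * t
      + ((-s : ℝ) : ℂ) * Complex.I * t) = (((σ + τ : ℝ) : ℂ) + ((-s : ℝ) : ℂ) * Complex.I)⁻¹ := by
    have := integral_exp_mul_complex_Iic
      (a := ((σ + τ : ℝ) : ℂ) + ((-s : ℝ) : ℂ) * Complex.I) (by simp; linarith) 0
    rw [Complex.ofReal_zero, mul_zero, Complex.exp_zero, one_div] at this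
    rw [← this]
    congr 1; ext t; congr 1; ring
  have key : ∫ t : ℝ, Complex.exp (((-2 * Real.pi * t * η : ℝ) : ℂ) * Complex.I) *
      ((profile τ σ t : ℝ) : ℂ) = (((σ - τ : ℝ) : ℂ) + (s : ℝ) * Complex.I)⁻¹
        + (((σ + τ : ℝ) : ℂ) + ((-s : ℝ) : ℂ) * Complex.I)⁻¹ := by
    rw [← intervalIntegral.integral_Iic_add_Ioi (b := 0) hint.integrableOn hint.integrableOn]
    rw [integral_Iic_eq_integral_Iio, setIntegral_congr_fun (g := fun t : ℝ =>
      Complex.exp (((σ + τ : ℝ) : ℂ) * t + ((-s : ℝ) : ℂ) * Complex.I * t)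
      - if σ < τ then Complex.exp (((τ - σ : ℝ) : ℂ) * t + ((-s : ℝ) : ℂ) * Complex.I * t) else 0)
      measurableSet_Iio, ← integral_Iic_eq_integral_Iio,
      setIntegral_congr_fun (s := Set.Ioi (0 : ℝ)) (g := fun t : ℝ => if τ < σ then
        Complex.exp ((-((σ - τ : ℝ) : ℂ) + ((-s : ℝ) : ℂ) * Complex.I) * t) else 0)
        measurableSet_Ioi]
    rotate_left
    · intro t ht
      have ht : 0 < t := ht
      simp only [profile, if_pos ht.le]
      split_ifs
      · rw [Complex.ofReal_exp, ← Complex.exp_add]; congr 1; rw [hs]; push_cast; ring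
      · simp
    · intro t ht
      have ht : t < 0 := ht
      simp only [profile, if_neg (not_le.2 ht)]
      push_cast
      rw [mul_sub]
      congr 1
      · rw [← Complex.exp_add]; congr 1; rw [hs]; push_cast; ring
      · split_ifs
        · rw [Complex.ofReal_exp, ← Complex.exp_add]; congr 1; rw [hs]; push_cast; ring
        · simp
    rcases lt_or_gt_of_ne h with h | h
    · simp only [h, if_true, not_lt.2 h.le, if_false, integral_zero, add_zero]
      have hre1 : 0 < (((σ + τ : ℝ) : ℂ) + ((-s : ℝ) : ℂ) * Complex.I).re := by simp; linarith
      have hre2 : 0 < (((τ - σ : ℝ) : ℂ) + ((-s : ℝ) : ℂ) * Complex.I).re := by simp; linarith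
      have e1 := integral_exp_mul_complex_Iic hre2 0
      rw [Complex.ofReal_zero, mul_zero, Complex.exp_zero] at e1
      simp only [← add_mul] at hneg ⊢
      rw [integral_sub (integrableOn_exp_mul_complex_Iic hre1 0)
        (integrableOn_exp_mul_complex_Iic hre2 0), hneg, e1]
      rw [show (((σ - τ : ℝ) : ℂ) + (s : ℝ) * Complex.I)
        = -(((τ - σ : ℝ) : ℂ) + ((-s : ℝ) : ℂ) * Complex.I) by push_cast; ring, inv_neg]
      ring
    · simp only [h, if_true, not_lt.2 h.le, if_false, sub_zero, hneg]
      rw [integral_exp_mul_complex_Ioi (by simp; linarith)]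
      rw [Complex.ofReal_zero, mul_zero, Complex.exp_zero, add_comm]
      congr 1
      rw [show (-((σ - τ : ℝ) : ℂ) + ((-s : ℝ) : ℂ) * Complex.I)
        = -(((σ - τ : ℝ) : ℂ) + (s : ℝ) * Complex.I) by push_cast; ring]
      rw [neg_div_neg_eq, one_div]
  rw [Real.fourier_real_eq_integral_exp_smul]
  have : ∀ t : ℝ, Complex.exp (((-2 * Real.pi * t * η : ℝ) : ℂ) * Complex.I) •
      ((profile τ σ t / (2 * σ) : ℝ) : ℂ)
      = (Complex.exp (((-2 * Real.pi * t * η : ℝ) : ℂ) * Complex.I) *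
      ((profile τ σ t : ℝ) : ℂ)) * (2 * (σ : ℂ))⁻¹ := by
    intro t; rw [smul_eq_mul]; push_cast; ring
  simp only [this]
  rw [integral_mul_const, key, hf, inv_add_inv hne1 hne2]
  field_simp
  push_cast
  ring

/-- The one-dimensional inverse Fourier transform of the inverse of the symbol. -/
lemma integral_exp_mul_inv_radialSymbol {τ σ : ℝ} (hτ : 0 ≤ τ) (hσ : 0 < σ) (h : σ ≠ τ) (t : ℝ) :
    ∫ η : ℝ, Complex.exp (((2 * Real.pi * (t * η) : ℝ) : ℂ) * Complex.I) *
        (radialSymbol τ σ (2 * Real.pi * η))⁻¹ = ((profile τ σ t / (2 * σ) : ℝ) : ℂ) := by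
  have hF : 𝓕 (fun t : ℝ => ((profile τ σ t / (2 * σ) : ℝ) : ℂ))
      = fun η : ℝ => (radialSymbol τ σ (2 * Real.pi * η))⁻¹ := funext (fourier_profile hτ hσ h)
  have hc : Continuous (fun t : ℝ => ((profile τ σ t / (2 * σ) : ℝ) : ℂ)) := by
    have := continuous_profile h
    fun_prop
  have hinv := hc.fourierInv_fourier_eq (((integrable_profile hτ hσ.le h).div_const (2 * σ)).ofReal)
    (by rw [hF]; exact integrable_inv_radialSymbol hτ hσ.le h)
  rw [hF] at hinv
  rw [← congrFun hinv t, Real.fourierInv_eq']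
  rfl

/-! ### Pointwise bound on the kernel -/

lemma norm_integral_exp_mul_circleWave_le (p q : ℝ) {s α β γ : ℝ} (h0α : 0 ≤ α)
    (hαβ : α ≤ β) (hα : 0 ≤ s * (α - γ)) (hβ : 0 ≤ s * (β - γ)) :
    ‖∫ ρ in α..β, (Real.exp (-(s * (ρ - γ))) : ℂ) * circleWave p q ρ‖
      * √(s ^ 2 + (p ^ 2 + q ^ 2)) ≤ 38 * Real.pi := by
  have h1 := norm_integral_exp_mul_circleWave_mul_abs_le p q hαβ hα hβ
  have h2 := norm_integral_exp_mul_circleWave_mul_sqrt_le p q h0α hαβ hα hβ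
  have h3 : √(s ^ 2 + (p ^ 2 + q ^ 2)) ≤ |s| + √(p ^ 2 + q ^ 2) := by
    refine Real.sqrt_le_iff.2 ⟨by positivity, ?_⟩
    have h4 := Real.sq_sqrt (show 0 ≤ p ^ 2 + q ^ 2 by positivity)
    have h5 := mul_nonneg (abs_nonneg s) (Real.sqrt_nonneg (p ^ 2 + q ^ 2))
    rw [add_sq, sq_abs, h4]
    linarith
  calc _ ≤ ‖∫ ρ in α..β, (Real.exp (-(s * (ρ - γ))) : ℂ) * circleWave p q ρ‖
        * (|s| + √(p ^ 2 + q ^ 2)) := by gcongr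
    _ ≤ _ := by rw [mul_add]; linarith

lemma integrable_profile_mul_circleWave {τ t : ℝ} (hτ : 0 ≤ τ) (ht : t ≠ 0) (p q : ℝ) :
    IntegrableOn (fun ρ => (profile τ ρ t : ℂ) * circleWave p q ρ) (Set.Ioi 0) := by
  have h0 := (((integrable_exp_neg_mul_abs (abs_pos.2 ht)).comp_sub_right τ).mul_const
    (2 * Real.pi)).integrableOn (s := Set.Ioi 0)
  refine Integrable.mono' h0 ?_ ?_
  · refine (Measurable.mul ?_ (continuous_circleWave p q).measurable).aestronglyMeasurable
    exact Complex.measurable_ofReal.comp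
      ((measurable_profile τ).comp (measurable_id.prodMk measurable_const))
  · filter_upwards [ae_restrict_mem measurableSet_Ioi] with ρ hρ
    rw [norm_mul, Complex.norm_real, Real.norm_eq_abs, mul_comm |ρ - τ|]
    gcongr
    · exact abs_profile_le hτ (le_of_lt hρ) t
    · exact norm_circleWave_le p q ρ

/-- The kernel of the inverse of the symbol, truncated to transversal frequencies at distance
less than `R` from the centre. -/
def truncKernel (τ R : ℝ) (x : ℝ × ℝ × ℝ) : ℂ :=
  (1 / 2) * ∫ ρ in (0 : ℝ)..R, (profile τ ρ x.1 : ℂ) * circleWave x.2.1 x.2.2 ρ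

/-- The kernel of the inverse of the symbol, up to a constant and a modulation. The value on the
null plane `x.1 = 0`, where the integral does not converge absolutely, is set to zero. -/
def radialKernel (τ : ℝ) (x : ℝ × ℝ × ℝ) : ℂ :=
  if x.1 = 0 then 0 else
    (1 / 2) * ∫ ρ in Set.Ioi (0 : ℝ), (profile τ ρ x.1 : ℂ) * circleWave x.2.1 x.2.2 ρ

/-- The Euclidean norm in coordinates. -/
def coordNorm (x : ℝ × ℝ × ℝ) : ℝ := √(x.1 ^ 2 + (x.2.1 ^ 2 + x.2.2 ^ 2))

/-- The pointwise bound on the truncated kernel, uniform in the truncation and in `τ`. -/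
lemma norm_truncKernel_mul_le {τ R : ℝ} (hτ : 0 ≤ τ) (hR : τ ≤ R) {x : ℝ × ℝ × ℝ} (hx : x.1 ≠ 0) :
    ‖truncKernel τ R x‖ * coordNorm x ≤ 38 * Real.pi := by
  obtain ⟨t, p, q⟩ := x
  simp only [truncKernel, coordNorm] at hx ⊢
  have hI : ∀ α β : ℝ, 0 ≤ α → α ≤ β → IntervalIntegrable
      (fun ρ => (profile τ ρ t : ℂ) * circleWave p q ρ) volume α β := fun α β hα hαβ =>
    (intervalIntegrable_iff_integrableOn_Ioc_of_le hαβ).2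
      ((integrable_profile_mul_circleWave hτ hx p q).mono_set
        (fun y hy => lt_of_le_of_lt hα hy.1))
  have hE : ∀ s γ α β : ℝ, IntervalIntegrable
      (fun ρ => (Real.exp (-(s * (ρ - γ))) : ℂ) * circleWave p q ρ) volume α β := fun s γ α β => by
    apply Continuous.intervalIntegrable; fun_prop
  have hsplit := intervalIntegral.integral_add_adjacent_intervals (hI 0 τ le_rfl hτ) (hI τ R hτ hR)
  have hhalf : ‖(1 / 2 : ℂ)‖ = 1 / 2 := by norm_num
  -- For `t < 0` both poles contribute when `ρ < τ`; for `t > 0` only `ρ > τ` contributes.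
  rcases lt_or_gt_of_ne hx with ht | ht
  · have e1 : ∫ ρ in (0 : ℝ)..τ, (profile τ ρ t : ℂ) * circleWave p q ρ
        = (∫ ρ in (0 : ℝ)..τ, (Real.exp (-((-t) * (ρ - (-τ)))) : ℂ) * circleWave p q ρ)
          - ∫ ρ in (0 : ℝ)..τ, (Real.exp (-(t * (ρ - τ))) : ℂ) * circleWave p q ρ := by
      rw [← intervalIntegral.integral_sub (hE _ _ _ _) (hE _ _ _ _),
        intervalIntegral.integral_of_le hτ, intervalIntegral.integral_of_le hτ,
        integral_Ioc_eq_integral_Ioo, integral_Ioc_eq_integral_Ioo]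
      refine setIntegral_congr_fun measurableSet_Ioo fun ρ hρ => ?_
      simp only [profile, if_neg (not_le.2 ht), if_pos hρ.2]
      rw [Complex.ofReal_sub, sub_mul]
      congr 4 <;> ring
    have e2 : ∫ ρ in τ..R, (profile τ ρ t : ℂ) * circleWave p q ρ
        = ∫ ρ in τ..R, (Real.exp (-((-t) * (ρ - (-τ)))) : ℂ) * circleWave p q ρ := by
      rw [intervalIntegral.integral_of_le hR, intervalIntegral.integral_of_le hR]
      refine setIntegral_congr_fun measurableSet_Ioc fun ρ hρ => ?_
      simp only [profile, if_neg (not_le.2 ht), if_neg (not_lt.2 hρ.1.le), sub_zero]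
      congr 3; ring
    have e3 : ∫ ρ in (0 : ℝ)..R, (profile τ ρ t : ℂ) * circleWave p q ρ
        = (∫ ρ in (0 : ℝ)..R, (Real.exp (-((-t) * (ρ - (-τ)))) : ℂ) * circleWave p q ρ)
          - ∫ ρ in (0 : ℝ)..τ, (Real.exp (-(t * (ρ - τ))) : ℂ) * circleWave p q ρ := by
      rw [← hsplit, e1, e2, ← intervalIntegral.integral_add_adjacent_intervals (hE (-t) (-τ) 0 τ)
        (hE (-t) (-τ) τ R)]
      ring
    rw [e3, norm_mul, hhalf]
    have b1 := norm_integral_exp_mul_circleWave_le p q (s := -t) (α := 0) (β := R) (γ := -τ) le_rfl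
      (hτ.trans hR) (by nlinarith) (by nlinarith)
    have b2 := norm_integral_exp_mul_circleWave_le p q (s := t) (α := 0) (β := τ) (γ := τ) le_rfl
      hτ (by nlinarith) (by simp)
    rw [neg_sq] at b1
    calc _ ≤ 1 / 2 * (‖∫ ρ in (0 : ℝ)..R,
            (Real.exp (-((-t) * (ρ - (-τ)))) : ℂ) * circleWave p q ρ‖
          + ‖∫ ρ in (0 : ℝ)..τ, (Real.exp (-(t * (ρ - τ))) : ℂ) * circleWave p q ρ‖)
          * √(t ^ 2 + (p ^ 2 + q ^ 2)) := by gcongr; exact norm_sub_le _ _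
      _ ≤ _ := by linarith
  · have e1 : ∫ ρ in (0 : ℝ)..τ, (profile τ ρ t : ℂ) * circleWave p q ρ = 0 := by
      rw [intervalIntegral.integral_of_le hτ]
      refine setIntegral_eq_zero_of_forall_eq_zero fun ρ hρ => ?_
      simp only [profile, if_pos ht.le, if_neg (not_lt.2 hρ.2)]
      simp
    have e2 : ∫ ρ in τ..R, (profile τ ρ t : ℂ) * circleWave p q ρ
        = ∫ ρ in τ..R, (Real.exp (-(t * (ρ - τ))) : ℂ) * circleWave p q ρ := by
      rw [intervalIntegral.integral_of_le hR, intervalIntegral.integral_of_le hR]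
      refine setIntegral_congr_fun measurableSet_Ioc fun ρ hρ => ?_
      simp only [profile, if_pos ht.le, if_pos hρ.1]
    rw [← hsplit, e1, e2, zero_add, norm_mul, hhalf]
    have b1 := norm_integral_exp_mul_circleWave_le p q (s := t) (α := τ) (β := R) (γ := τ) hτ
      hR (by simp) (by nlinarith)
    have := Real.pi_pos
    linarith

lemma tendsto_truncKernel {τ : ℝ} (hτ : 0 ≤ τ) {x : ℝ × ℝ × ℝ} (hx : x.1 ≠ 0) :
    Tendsto (fun R => truncKernel τ R x) atTop (𝓝 (radialKernel τ x)) := by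
  simp only [radialKernel, if_neg hx, truncKernel]
  exact (intervalIntegral_tendsto_integral_Ioi 0
    (integrable_profile_mul_circleWave hτ hx _ _) tendsto_id).const_mul _

/-- The pointwise bound on the kernel, uniform in `τ`. -/
lemma norm_radialKernel_mul_le {τ : ℝ} (hτ : 0 ≤ τ) (x : ℝ × ℝ × ℝ) :
    ‖radialKernel τ x‖ * coordNorm x ≤ 38 * Real.pi := by
  by_cases hx : x.1 = 0
  · simp [radialKernel, hx, Real.pi_pos.le]
  · refine le_of_tendsto ((tendsto_truncKernel hτ hx).norm.mul_const _) ?_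
    filter_upwards [eventually_ge_atTop τ] with R hR
    exact norm_truncKernel_mul_le hτ hR hx

lemma continuous_circleWave_uncurry :
    Continuous (fun x : (ℝ × ℝ) × ℝ => circleWave x.1.1 x.1.2 x.2) := by
  unfold circleWave circleMoment phase
  apply intervalIntegral.continuous_parametric_intervalIntegral_of_continuous'
  fun_prop

lemma measurable_profile_mul_circleWave (τ : ℝ) :
    Measurable (fun y : (ℝ × ℝ × ℝ) × ℝ =>
      (profile τ y.2 y.1.1 : ℂ) * circleWave y.1.2.1 y.1.2.2 y.2) := by
  refine Measurable.mul ?_ ?_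
  · exact Complex.measurable_ofReal.comp ((measurable_profile τ).comp
      (f := fun y : (ℝ × ℝ × ℝ) × ℝ => (y.2, y.1.1)) (by fun_prop))
  · exact continuous_circleWave_uncurry.measurable.comp
      (g := fun x : (ℝ × ℝ) × ℝ => circleWave x.1.1 x.1.2 x.2)
      (f := fun y : (ℝ × ℝ × ℝ) × ℝ => ((y.1.2.1, y.1.2.2), y.2)) (by fun_prop)

lemma measurable_radialKernel (τ : ℝ) : Measurable (radialKernel τ) := by
  unfold radialKernel
  refine Measurable.ite (measurableSet_eq_fun measurable_fst measurable_const) measurable_const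
    (Measurable.const_mul ?_ _)
  exact ((measurable_profile_mul_circleWave τ).stronglyMeasurable.integral_prod_right'
    (ν := volume.restrict (Set.Ioi 0))).measurable

lemma measurable_truncKernel (τ R : ℝ) (hR : 0 ≤ R) : Measurable (truncKernel τ R) := by
  unfold truncKernel
  refine (Measurable.const_mul ?_ _)
  simp only [intervalIntegral.integral_of_le hR]
  exact ((measurable_profile_mul_circleWave τ).stronglyMeasurable.integral_prod_right'
    (ν := volume.restrict (Set.Ioc 0 R))).measurable

/-- The Euclidean norm on the transversal plane. -/
def planeNorm (ζ : ℝ × ℝ) : ℝ := √(ζ.1 ^ 2 + ζ.2 ^ 2)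

@[fun_prop]
lemma continuous_planeNorm : Continuous planeNorm := by unfold planeNorm; fun_prop

lemma planeNorm_nonneg (ζ : ℝ × ℝ) : 0 ≤ planeNorm ζ := Real.sqrt_nonneg _

lemma planeNorm_polarCoord_symm {x : ℝ × ℝ} (hx : 0 ≤ x.1) :
    planeNorm (polarCoord.symm x) = x.1 := by
  simp only [planeNorm, polarCoord_symm_apply]
  rw [show (x.1 * Real.cos x.2) ^ 2 + (x.1 * Real.sin x.2) ^ 2
    = x.1 ^ 2 * (Real.sin x.2 ^ 2 + Real.cos x.2 ^ 2) by ring, Real.sin_sq_add_cos_sq, mul_one,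
    Real.sqrt_sq hx]

/-- The planar Fourier integral that defines the truncated kernel, in polar coordinates. -/
lemma setIntegral_planeNorm_lt_eq_truncKernel {τ R : ℝ} (hτ : 0 ≤ τ) (hR : 0 ≤ R) (t p q : ℝ) :
    ∫ ζ in {ζ : ℝ × ℝ | planeNorm ζ < R}, Complex.exp (Complex.I * (p * ζ.1 + q * ζ.2 : ℝ))
        * ((profile τ (planeNorm ζ) t / (2 * planeNorm ζ) : ℝ) : ℂ)
      = truncKernel τ R (t, p, q) := by
  have hmeas : MeasurableSet {ζ : ℝ × ℝ | planeNorm ζ < R} :=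
    measurableSet_lt (by fun_prop) measurable_const
  rw [← integral_indicator hmeas, ← integral_comp_polarCoord_symm]
  have hcongr : ∫ x in polarCoord.target, x.1 • Set.indicator {ζ : ℝ × ℝ | planeNorm ζ < R}
      (fun ζ => Complex.exp (Complex.I * (p * ζ.1 + q * ζ.2 : ℝ))
        * ((profile τ (planeNorm ζ) t / (2 * planeNorm ζ) : ℝ) : ℂ)) (polarCoord.symm x)
      = ∫ x in Set.Ioi (0 : ℝ) ×ˢ Set.Ioo (-Real.pi) Real.pi, Set.indicator (Set.Ioo 0 R ×ˢ Set.univ)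
        (fun x : ℝ × ℝ => (1 / 2 * (profile τ x.1 t : ℂ)) *
          Complex.exp (Complex.I * (x.1 * phase p q x.2 : ℝ))) x := by
    rw [polarCoord_target]
    refine setIntegral_congr_fun (measurableSet_Ioi.prod measurableSet_Ioo) fun x hx => ?_
    have hx0 : 0 < x.1 := hx.1
    have hxc : (x.1 : ℂ) ≠ 0 := by exact_mod_cast hx0.ne'
    simp only [Set.indicator_apply, Set.mem_ofPred_eq, planeNorm_polarCoord_symm hx0.le,
      Set.mem_prod, Set.mem_Ioo, Set.mem_univ, and_true, hx0, true_and]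
    split_ifs
    · simp only [polarCoord_symm_apply, Complex.real_smul]
      rw [show p * (x.1 * Real.cos x.2) + q * (x.1 * Real.sin x.2) = x.1 * phase p q x.2 by
        unfold phase; ring]
      push_cast
      field_simp
    · simp
  rw [hcongr, setIntegral_indicator (measurableSet_Ioo.prod MeasurableSet.univ), Set.prod_inter_prod,
    Set.inter_univ, Set.inter_eq_right.2 (fun y hy => hy.1), Measure.volume_eq_prod,
    setIntegral_prod]
  · simp only [integral_const_mul]
    unfold truncKernel circleWave circleMoment
    rw [intervalIntegral.integral_of_le hR, integral_Ioc_eq_integral_Ioo, ← integral_const_mul]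
    congr 1; ext ρ
    rw [intervalIntegral.integral_of_le (by linarith [Real.pi_pos]), integral_Ioc_eq_integral_Ioo]
    simp only [one_mul]
    ring
  · have hfin : IsFiniteMeasure ((volume.prod volume).restrict
        (Set.Ioo 0 R ×ˢ Set.Ioo (-Real.pi) Real.pi) : Measure (ℝ × ℝ)) := by
      refine ⟨?_⟩
      rw [Measure.restrict_apply_univ, Measure.prod_prod]
      exact ENNReal.mul_lt_top (by simp) (by simp)
    refine Integrable.of_bound (C := 1 / 2) ?_ ?_
    · apply Measurable.aestronglyMeasurable
      refine Measurable.mul (Measurable.const_mul (Complex.measurable_ofReal.comp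
        ((measurable_profile τ).comp (f := fun x : ℝ × ℝ => (x.1, t)) (by fun_prop))) _) ?_
      unfold phase
      fun_prop
    · filter_upwards [ae_restrict_mem (measurableSet_Ioo.prod measurableSet_Ioo)] with x hx
      rw [norm_mul, norm_exp_I_mul, mul_one, norm_mul, Complex.norm_real, Real.norm_eq_abs]
      have := abs_profile_le_one hτ (le_of_lt hx.1.1) t
      norm_num
      linarith

/-! ### The Fourier identity in coordinates -/

/-- The transversal frequency, measured from the centre of the circle of zeros of the symbol. -/
def transFreq (a y : ℝ × ℝ) : ℝ × ℝ := (2 * Real.pi) • y + a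

@[fun_prop]
lemma continuous_transFreq (a : ℝ × ℝ) : Continuous (transFreq a) := by unfold transFreq; fun_prop

/-- The symbol `𝔭_z(2π η)` in coordinates, where `τ` is the length of `Im z` and `a` holds the
transversal coordinates of `Re z`. -/
def coordSymbol (τ : ℝ) (a : ℝ × ℝ) (η : ℝ × ℝ × ℝ) : ℂ :=
  radialSymbol τ (planeNorm (transFreq a η.2)) (2 * Real.pi * η.1)

lemma continuous_coordSymbol (τ : ℝ) (a : ℝ × ℝ) : Continuous (coordSymbol τ a) := by
  unfold coordSymbol radialSymbol
  fun_prop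

/-- The plane wave `exp(2πi x·η)` in coordinates. -/
def coordWave (x η : ℝ × ℝ × ℝ) : ℂ :=
  Complex.exp (((2 * Real.pi * (x.1 * η.1 + (x.2.1 * η.2.1 + x.2.2 * η.2.2)) : ℝ) : ℂ) * Complex.I)

lemma norm_coordWave (x η : ℝ × ℝ × ℝ) : ‖coordWave x η‖ = 1 := Complex.norm_exp_ofReal_mul_I _

lemma continuous_coordWave :
    Continuous (fun y : (ℝ × ℝ × ℝ) × (ℝ × ℝ × ℝ) => coordWave y.1 y.2) := by
  unfold coordWave; fun_prop

/-- The convolution kernel of the inverse of the symbol in coordinates. -/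
def coordKernel (τ : ℝ) (a : ℝ × ℝ) (x : ℝ × ℝ × ℝ) : ℂ :=
  (((2 * Real.pi) ^ 2)⁻¹ : ℝ) * (Complex.exp (Complex.I * (-(x.2.1 * a.1 + x.2.2 * a.2) : ℝ))
    * radialKernel τ x)

lemma measurable_coordKernel (τ : ℝ) (a : ℝ × ℝ) : Measurable (coordKernel τ a) := by
  unfold coordKernel
  exact (Measurable.mul (by fun_prop) (measurable_radialKernel τ)).const_mul _

lemma integral_comp_transFreq (a : ℝ × ℝ) (F : ℝ × ℝ → ℂ) :
    ∫ y, F (transFreq a y) = ((((2 * Real.pi) ^ 2)⁻¹ : ℝ) : ℂ) * ∫ ζ, F ζ := by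
  unfold transFreq
  rw [Measure.integral_comp_smul volume (fun y => F (y + a)) (2 * Real.pi),
    integral_add_right_eq_self (fun y => F y) a]
  simp only [Module.finrank_prod, Module.finrank_self]
  rw [abs_of_nonneg (by positivity), Complex.real_smul]

lemma integrable_comp_transFreq (a : ℝ × ℝ) {F : ℝ × ℝ → ℝ} (hF : Integrable F) :
    Integrable (fun y => F (transFreq a y)) := by
  unfold transFreq
  exact (hF.comp_add_right a).comp_smul Real.two_pi_pos.ne'

lemma ae_planeNorm_transFreq_ne (a : ℝ × ℝ) (c : ℝ) :
    ∀ᵐ y : ℝ × ℝ, planeNorm (transFreq a y) ≠ c := by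
  have hm : MeasurableSet {y : ℝ × ℝ | planeNorm (transFreq a y) = c} :=
    measurableSet_eq_fun (by fun_prop) measurable_const
  have h0 : (volume : Measure (ℝ × ℝ)) {y : ℝ × ℝ | planeNorm (transFreq a y) = c} = 0 := by
    rw [Measure.volume_eq_prod, Measure.measure_prod_null hm]
    refine Eventually.of_forall fun y₁ => ?_
    set d := c ^ 2 - (2 * Real.pi * y₁ + a.1) ^ 2 with hd
    have hpi := Real.pi_pos
    refine measure_mono_null (t := {(√d - a.2) / (2 * Real.pi), (-√d - a.2) / (2 * Real.pi)}) ?_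
      ((Set.toFinite _).measure_zero _)
    intro y₂ hy
    have hy : planeNorm (transFreq a (y₁, y₂)) = c := hy
    have h1 : (2 * Real.pi * y₁ + a.1) ^ 2 + (2 * Real.pi * y₂ + a.2) ^ 2 = c ^ 2 := by
      rw [← hy, planeNorm, Real.sq_sqrt (by positivity)]
      simp [transFreq]
    have h2 : (2 * Real.pi * y₂ + a.2) ^ 2 = d := by rw [hd]; linarith
    have h3 : √d = |2 * Real.pi * y₂ + a.2| := by rw [← h2, Real.sqrt_sq_eq_abs]
    rcases abs_choice (2 * Real.pi * y₂ + a.2) with h | h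
    · left; rw [h3, h]; field_simp; ring
    · right; rw [Set.mem_singleton_iff, h3, h]; field_simp; ring
  rw [ae_iff]
  simpa using h0

/-- The norm on `ℝ × ℝ` is the maximum norm. -/
lemma norm_le_planeNorm (ζ : ℝ × ℝ) : ‖ζ‖ ≤ planeNorm ζ := by
  rw [Prod.norm_def]
  refine max_le (Real.abs_le_sqrt ?_) (Real.abs_le_sqrt ?_) <;>
    nlinarith [sq_nonneg ζ.1, sq_nonneg ζ.2]

lemma integrable_indicator_inv_planeNorm (R : ℝ) :
    Integrable (Set.indicator {ζ : ℝ × ℝ | planeNorm ζ < R} fun ζ => (planeNorm ζ)⁻¹) := by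
  have hmeas : MeasurableSet {ζ : ℝ × ℝ | planeNorm ζ < R} :=
    measurableSet_lt (by fun_prop) measurable_const
  rw [integrable_indicator_iff hmeas]
  refine (integrableOn_ball_of_norm_le_rpow (C := 1) (α := 1) (r := R) (by simp) (by simp) ?_
    ?_).mono_set (t := Metric.ball 0 R) ?_
  · refine Eventually.of_forall fun ζ => ?_
    rw [one_mul, Real.rpow_neg_one, norm_inv, Real.norm_of_nonneg (planeNorm_nonneg ζ)]
    rcases eq_or_ne ζ 0 with h | h
    · simp [h, planeNorm]
    · exact inv_anti₀ (norm_pos_iff.2 h) (norm_le_planeNorm ζ)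
  · exact (Measurable.inv (by fun_prop)).aestronglyMeasurable
  · intro ζ hζ
    rw [mem_ball_zero_iff]
    exact (norm_le_planeNorm ζ).trans_lt hζ

lemma integrable_coordWave_mul {S : ℝ → ℂ} (hS : Integrable S) {φ : ℝ × ℝ × ℝ → ℂ}
    (hφ : Integrable φ) (y : ℝ × ℝ) :
    Integrable (fun z : ℝ × (ℝ × ℝ × ℝ) => coordWave z.2 (z.1, y) * (S z.1 * φ z.2))
      (volume.prod volume) := by
  refine Integrable.bdd_mul (c := 1) (hS.mul_prod hφ) ?_ (Eventually.of_forall fun z => ?_)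
  · refine Continuous.aestronglyMeasurable ?_
    exact continuous_coordWave.comp
      (f := fun z : ℝ × ℝ × ℝ × ℝ => (z.2, (z.1, y))) (by fun_prop)
  · exact (norm_coordWave _ _).le

lemma coordWave_mk (x : ℝ × ℝ × ℝ) (η₁ : ℝ) (y : ℝ × ℝ) :
    coordWave x (η₁, y) = coordWave x (0, y) *
      Complex.exp (((2 * Real.pi * (x.1 * η₁) : ℝ) : ℂ) * Complex.I) := by
  unfold coordWave
  rw [← Complex.exp_add]
  congr 1
  push_cast
  ring

/-- Integration of the inverse of the symbol along the direction of `Im z`. -/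
lemma integral_inv_coordSymbol_mul (τ : ℝ) (hτ : 0 ≤ τ) (a : ℝ × ℝ) {φ : ℝ × ℝ × ℝ → ℂ}
    (hφ : Integrable φ) {y : ℝ × ℝ} (hy : planeNorm (transFreq a y) ≠ τ)
    (hy0 : planeNorm (transFreq a y) ≠ 0) :
    ∫ η₁ : ℝ, (coordSymbol τ a (η₁, y))⁻¹ * ∫ x, coordWave x (η₁, y) * φ x
      = ∫ x, φ x * (coordWave x (0, y) * ((profile τ (planeNorm (transFreq a y)) x.1
          / (2 * planeNorm (transFreq a y)) : ℝ) : ℂ)) := by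
  have hσ : 0 < planeNorm (transFreq a y) := lt_of_le_of_ne (planeNorm_nonneg _) (Ne.symm hy0)
  have hS : Integrable (fun η₁ : ℝ => (coordSymbol τ a (η₁, y))⁻¹) := by
    simp only [coordSymbol]
    exact integrable_inv_radialSymbol hτ hσ.le hy
  have h1 := integral_integral_swap (f := fun (η₁ : ℝ) (x : ℝ × ℝ × ℝ) =>
    coordWave x (η₁, y) * ((coordSymbol τ a (η₁, y))⁻¹ * φ x)) (integrable_coordWave_mul hS hφ y)
  have h2 : ∀ η₁ : ℝ, (coordSymbol τ a (η₁, y))⁻¹ * ∫ x, coordWave x (η₁, y) * φ x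
      = ∫ x, coordWave x (η₁, y) * ((coordSymbol τ a (η₁, y))⁻¹ * φ x) := by
    intro η₁
    rw [← integral_const_mul]
    congr 1; ext x; ring
  rw [integral_congr_ae (Eventually.of_forall h2), h1]
  congr 1; ext x
  rw [← integral_exp_mul_inv_radialSymbol hτ hσ hy x.1, ← integral_const_mul, ← integral_const_mul]
  congr 1; ext η₁
  rw [coordWave_mk, coordSymbol]
  ring

/-- The Fourier identity with truncated transversal frequencies, where Fubini applies. -/
lemma setIntegral_inv_coordSymbol_mul {τ R : ℝ} (hτ : 0 ≤ τ) (hR : 0 ≤ R) (a : ℝ × ℝ)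
    {φ : ℝ × ℝ × ℝ → ℂ} (hφ : Integrable φ) :
    ∫ y in {y | planeNorm (transFreq a y) < R}, ∫ η₁ : ℝ,
        (coordSymbol τ a (η₁, y))⁻¹ * ∫ x, coordWave x (η₁, y) * φ x
      = ∫ x, φ x * ((((2 * Real.pi) ^ 2)⁻¹ : ℝ) *
          (Complex.exp (Complex.I * (-(x.2.1 * a.1 + x.2.2 * a.2) : ℝ)) * truncKernel τ R x)) := by
  -- On the truncated domain the weight `1 / |ζ|` is integrable, and the profile is at most one.
  set D := {y : ℝ × ℝ | planeNorm (transFreq a y) < R}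
  have hmeas : MeasurableSet D := measurableSet_lt (by fun_prop) measurable_const
  have hmeas' : MeasurableSet {ζ : ℝ × ℝ | planeNorm ζ < R} :=
    measurableSet_lt (by fun_prop) measurable_const
  have hDint : IntegrableOn (fun y => (planeNorm (transFreq a y))⁻¹) D := by
    rw [← integrable_indicator_iff hmeas]
    exact integrable_comp_transFreq a (integrable_indicator_inv_planeNorm R)
  have hint : Integrable (Function.uncurry fun (y : ℝ × ℝ) (x : ℝ × ℝ × ℝ) =>
      φ x * (coordWave x (0, y) * ((profile τ (planeNorm (transFreq a y)) x.1
          / (2 * planeNorm (transFreq a y)) : ℝ) : ℂ))) ((volume.restrict D).prod volume) := by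
    refine Integrable.mono' (hDint.mul_prod hφ.norm) ?_ (Eventually.of_forall fun z => ?_)
    · refine AEStronglyMeasurable.mul hφ.aestronglyMeasurable.comp_snd ?_
      apply Measurable.aestronglyMeasurable
      refine Measurable.mul ?_ (Complex.measurable_ofReal.comp (Measurable.div ?_ (by fun_prop)))
      · exact (continuous_coordWave.comp
          (f := fun z : (ℝ × ℝ) × ℝ × ℝ × ℝ => (z.2, ((0 : ℝ), z.1))) (by fun_prop)).measurable
      · exact (measurable_profile τ).comp
          (f := fun z : (ℝ × ℝ) × ℝ × ℝ × ℝ => (planeNorm (transFreq a z.1), z.2.1)) (by fun_prop)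
    · obtain ⟨y, x⟩ := z
      simp only [Function.uncurry]
      rw [norm_mul, norm_mul, norm_coordWave, one_mul, Complex.norm_real, Real.norm_eq_abs,
        abs_div, mul_comm]
      have h1 := abs_profile_le_one hτ (planeNorm_nonneg (transFreq a y)) x.1
      gcongr
      rw [abs_mul, abs_two, abs_of_nonneg (planeNorm_nonneg _)]
      rcases (planeNorm_nonneg (transFreq a y)).eq_or_lt with h | h
      · rw [← h]; simp
      · rw [div_le_iff₀ (by positivity)]
        field_simp
        linarith
  have hae : ∀ᵐ y ∂(volume.restrict D), ∫ η₁ : ℝ,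
        (coordSymbol τ a (η₁, y))⁻¹ * ∫ x, coordWave x (η₁, y) * φ x
      = ∫ x, φ x * (coordWave x (0, y) * ((profile τ (planeNorm (transFreq a y)) x.1
          / (2 * planeNorm (transFreq a y)) : ℝ) : ℂ)) := by
    filter_upwards [ae_restrict_of_ae (ae_planeNorm_transFreq_ne a τ),
      ae_restrict_of_ae (ae_planeNorm_transFreq_ne a 0)] with y h1 h2
    exact integral_inv_coordSymbol_mul τ hτ a hφ h1 h2
  rw [integral_congr_ae hae, integral_integral_swap hint]
  congr 1; ext x
  rw [integral_const_mul]
  congr 1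
  have h1 := setIntegral_planeNorm_lt_eq_truncKernel hτ hR x.1 x.2.1 x.2.2
  rw [← h1, ← integral_indicator hmeas', ← integral_indicator hmeas, ← integral_const_mul,
    ← integral_comp_transFreq a]
  congr 1; ext y
  have hind : y ∈ D ↔ transFreq a y ∈ {ζ : ℝ × ℝ | planeNorm ζ < R} := Iff.rfl
  by_cases hy : y ∈ D
  · rw [Set.indicator_of_mem hy, Set.indicator_of_mem (hind.1 hy), ← mul_assoc, ← Complex.exp_add]
    congr 2
    simp only [coordWave, transFreq, Prod.fst_add, Prod.snd_add, Prod.smul_fst, Prod.smul_snd,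
      smul_eq_mul]
    congr 1
    push_cast
    ring
  · rw [Set.indicator_of_notMem hy, Set.indicator_of_notMem (fun h => hy (hind.2 h)), mul_zero]

lemma ae_fst_ne_zero : ∀ᵐ x : ℝ × ℝ × ℝ, x.1 ≠ 0 :=
  Measure.quasiMeasurePreserving_fst.ae
    (p := fun t : ℝ => t ≠ 0) (by simp [ae_iff])

lemma coordNorm_pos {x : ℝ × ℝ × ℝ} (hx : x.1 ≠ 0) : 0 < coordNorm x :=
  Real.sqrt_pos.2 (by positivity)

/-- The kernel represents the inverse of the symbol: the pairing on the Fourier side equals the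
pairing with `coordKernel`. -/
lemma integral_inv_coordSymbol_mul_eq {τ : ℝ} (hτ : 0 ≤ τ) (a : ℝ × ℝ)
    {φ : ℝ × ℝ × ℝ → ℂ} (hφ : Integrable φ) (hφ' : Integrable (fun x => ‖φ x‖ * (coordNorm x)⁻¹))
    (hψ : Integrable (fun η => (coordSymbol τ a η)⁻¹ * ∫ x, coordWave x η * φ x)) :
    ∫ η, (coordSymbol τ a η)⁻¹ * ∫ x, coordWave x η * φ x = ∫ x, φ x * coordKernel τ a x := by
  have hleft : Tendsto (fun R : ℝ => ∫ y in {y | planeNorm (transFreq a y) < R}, ∫ η₁ : ℝ,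
        (coordSymbol τ a (η₁, y))⁻¹ * ∫ x, coordWave x (η₁, y) * φ x) atTop
      (𝓝 (∫ η, (coordSymbol τ a η)⁻¹ * ∫ x, coordWave x η * φ x)) := by
    have hprod : ∫ η, (coordSymbol τ a η)⁻¹ * ∫ x, coordWave x η * φ x
        = ∫ y : ℝ × ℝ, ∫ η₁ : ℝ, (coordSymbol τ a (η₁, y))⁻¹ * ∫ x, coordWave x (η₁, y) * φ x :=
      integral_prod_symm _ hψ
    rw [hprod]
    have hmeas : ∀ R : ℝ, MeasurableSet {y : ℝ × ℝ | planeNorm (transFreq a y) < R} := fun R =>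
      measurableSet_lt (by fun_prop) measurable_const
    simp only [← integral_indicator (hmeas _)]
    have hG := hψ.integral_prod_right
    refine tendsto_integral_filter_of_dominated_convergence _
      (Eventually.of_forall fun R => hG.aestronglyMeasurable.indicator (hmeas R))
      (Eventually.of_forall fun R => Eventually.of_forall fun y => norm_indicator_le_norm_self _ _)
      hG.norm (Eventually.of_forall fun y => ?_)
    refine tendsto_const_nhds.congr' ?_
    filter_upwards [eventually_gt_atTop (planeNorm (transFreq a y))] with R hR
    have hy : y ∈ {y : ℝ × ℝ | planeNorm (transFreq a y) < R} := hR
    rw [Set.indicator_of_mem hy]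
  have hright : Tendsto (fun R : ℝ => ∫ x, φ x * ((((2 * Real.pi) ^ 2)⁻¹ : ℝ) *
          (Complex.exp (Complex.I * (-(x.2.1 * a.1 + x.2.2 * a.2) : ℝ)) * truncKernel τ R x)))
      atTop (𝓝 (∫ x, φ x * coordKernel τ a x)) := by
    refine tendsto_integral_filter_of_dominated_convergence
      (fun x => ((2 * Real.pi) ^ 2)⁻¹ * (38 * Real.pi) * (‖φ x‖ * (coordNorm x)⁻¹)) ?_ ?_
      (hφ'.const_mul _) ?_
    · filter_upwards [eventually_ge_atTop (0 : ℝ)] with R hR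
      refine hφ.aestronglyMeasurable.mul (Measurable.aestronglyMeasurable ?_)
      exact (Measurable.mul (by fun_prop) (measurable_truncKernel τ R hR)).const_mul _
    · filter_upwards [eventually_ge_atTop τ] with R hR
      filter_upwards [ae_fst_ne_zero] with x hx
      rw [norm_mul, norm_mul, norm_mul, norm_exp_I_mul, one_mul, Complex.norm_real,
        Real.norm_of_nonneg (by positivity)]
      have h1 : ‖truncKernel τ R x‖ ≤ 38 * Real.pi * (coordNorm x)⁻¹ := by
        rw [← div_eq_mul_inv, le_div_iff₀ (coordNorm_pos hx)]
        exact norm_truncKernel_mul_le hτ hR hx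
      calc _ ≤ ‖φ x‖ * (((2 * Real.pi) ^ 2)⁻¹ * (38 * Real.pi * (coordNorm x)⁻¹)) := by gcongr
        _ = _ := by ring
    · filter_upwards [ae_fst_ne_zero] with x hx
      exact (((tendsto_truncKernel hτ hx).const_mul _).const_mul _).const_mul _
  refine tendsto_nhds_unique hleft (hright.congr' ?_)
  filter_upwards [eventually_ge_atTop 0] with R hR
  exact (setIntegral_inv_coordSymbol_mul hτ hR a hφ).symm

lemma integrable_inv_sqrt_mul (τ : ℝ) :
    Integrable (fun x : ℝ => (√|x - τ|)⁻¹ * (1 + x ^ 2)⁻¹) := by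
  have h0 : Integrable (Set.indicator (Metric.ball (0 : ℝ) 1) fun u : ℝ => (√|u|)⁻¹) := by
    rw [integrable_indicator_iff Metric.isOpen_ball.measurableSet]
    refine integrableOn_ball_of_norm_le_rpow (C := 1) (α := 1 / 2) (by simp) (by norm_num)
      (Eventually.of_forall fun u => ?_) (by fun_prop)
    rw [norm_inv, Real.norm_of_nonneg (Real.sqrt_nonneg _), Real.rpow_neg (norm_nonneg _),
      ← Real.sqrt_eq_rpow, one_mul, Real.norm_eq_abs]
  refine ((h0.comp_sub_right τ).add integrable_inv_one_add_sq).mono' (by fun_prop)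
    (Eventually.of_forall fun x => ?_)
  rw [Real.norm_of_nonneg (by positivity), Pi.add_apply]
  have h1 : (1 + x ^ 2)⁻¹ ≤ 1 := inv_le_one_of_one_le₀ (by nlinarith [sq_nonneg x])
  have h2 : 0 ≤ (1 + x ^ 2)⁻¹ := by positivity
  have h3 : 0 ≤ (√|x - τ|)⁻¹ := by positivity
  by_cases hx : x - τ ∈ Metric.ball (0 : ℝ) 1
  · rw [Set.indicator_of_mem hx]
    nlinarith
  · rw [Set.indicator_of_notMem hx, zero_add]
    have h4 : 1 ≤ |x - τ| := by simpa using hx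
    have h5 : (√|x - τ|)⁻¹ ≤ 1 := inv_le_one_of_one_le₀ (Real.one_le_sqrt.2 h4)
    nlinarith

/-- In the plane, the inverse distance to a circle is integrable to the power `1 / 2`, even with an
additional factor `1 / |ζ|`. -/
lemma integrable_inv_planeNorm_mul (τ : ℝ) :
    Integrable (fun ζ : ℝ × ℝ => (planeNorm ζ * √|planeNorm ζ - τ|)⁻¹ * (1 + planeNorm ζ ^ 2)⁻¹) := by
  rw [← Complex.volume_preserving_equiv_real_prod.integrable_comp_emb
    Complex.measurableEquivRealProd.measurableEmbedding]
  have h1 : ((fun ζ : ℝ × ℝ => (planeNorm ζ * √|planeNorm ζ - τ|)⁻¹ * (1 + planeNorm ζ ^ 2)⁻¹)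
      ∘ Complex.measurableEquivRealProd)
      = fun z : ℂ => (fun ρ : ℝ => (ρ * √|ρ - τ|)⁻¹ * (1 + ρ ^ 2)⁻¹) ‖z‖ := by
    ext z
    have : planeNorm (Complex.measurableEquivRealProd z) = ‖z‖ := by
      rw [Complex.norm_eq_sqrt_sq_add_sq]; rfl
    simp only [Function.comp, this]
  rw [h1]
  refine (integrable_fun_norm_addHaar (volume : Measure ℂ)
    (f := fun ρ : ℝ => (ρ * √|ρ - τ|)⁻¹ * (1 + ρ ^ 2)⁻¹)).2 ?_
  refine (integrable_inv_sqrt_mul τ).integrableOn.congr_fun (fun ρ hρ => ?_) measurableSet_Ioi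
  have hρ : (0 : ℝ) < ρ := hρ
  simp only [Complex.finrank_real_complex, smul_eq_mul, mul_inv]
  rw [show 2 - 1 = 1 from rfl, pow_one]
  field_simp

/-- The inverse of the symbol is integrable against a rapidly decreasing weight. -/
lemma integrable_inv_coordSymbol_mul {τ : ℝ} (hτ : 0 ≤ τ) (a : ℝ × ℝ) :
    Integrable (fun η : ℝ × ℝ × ℝ => (coordSymbol τ a η)⁻¹ *
      (((1 + η.1 ^ 2)⁻¹ * (1 + planeNorm η.2 ^ 2)⁻¹ : ℝ) : ℂ)) := by
  have hpi := Real.pi_pos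
  have f1 : Integrable (fun s : ℝ => (√(2 * Real.pi))⁻¹ * ((√|s - 0|)⁻¹ * (1 + s ^ 2)⁻¹)) :=
    (integrable_inv_sqrt_mul 0).const_mul _
  set K := 8 * Real.pi ^ 2 + 1 + 2 * (a.1 ^ 2 + a.2 ^ 2) with hK
  have f2 := (integrable_comp_transFreq a (integrable_inv_planeNorm_mul τ)).const_mul K
  refine (f1.mul_prod f2).mono' ?_ ?_
  · apply Measurable.aestronglyMeasurable
    exact ((continuous_coordSymbol τ a).measurable.inv).mul (by fun_prop)
  have g1 : ∀ᵐ η : ℝ × ℝ × ℝ, planeNorm (transFreq a η.2) ≠ τ :=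
    Measure.quasiMeasurePreserving_snd.ae (ae_planeNorm_transFreq_ne a τ)
  have g2 : ∀ᵐ η : ℝ × ℝ × ℝ, planeNorm (transFreq a η.2) ≠ 0 :=
    Measure.quasiMeasurePreserving_snd.ae (ae_planeNorm_transFreq_ne a 0)
  filter_upwards [g1, g2, ae_fst_ne_zero] with η h1 h2 h3
  set σ := planeNorm (transFreq a η.2) with hσ
  have hσ0 : 0 < σ := lt_of_le_of_ne (planeNorm_nonneg _) (Ne.symm h2)
  have hb : ‖(coordSymbol τ a η)⁻¹‖ ≤ (σ * (√|σ - τ| * √|2 * Real.pi * η.1|))⁻¹ := by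
    rw [norm_inv]
    refine inv_anti₀ ?_ (mul_sqrt_le_norm_radialSymbol hτ hσ0.le _)
    have : 0 < |σ - τ| := abs_pos.2 (sub_ne_zero.2 h1)
    have : 0 < |2 * Real.pi * η.1| := by positivity
    positivity
  have hw : (1 + planeNorm η.2 ^ 2)⁻¹ ≤ K * (1 + σ ^ 2)⁻¹ := by
    rw [← div_eq_mul_inv, inv_eq_one_div, div_le_div_iff₀ (by positivity) (by positivity), one_mul]
    rw [hσ, planeNorm, planeNorm, Real.sq_sqrt (by positivity), Real.sq_sqrt (by positivity)]
    simp only [transFreq, Prod.fst_add, Prod.snd_add, Prod.smul_fst, Prod.smul_snd, smul_eq_mul]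
    have e1 : (2 * Real.pi * η.2.1 + a.1) ^ 2 ≤ 8 * Real.pi ^ 2 * η.2.1 ^ 2 + 2 * a.1 ^ 2 := by
      nlinarith [sq_nonneg (2 * Real.pi * η.2.1 - a.1)]
    have e2 : (2 * Real.pi * η.2.2 + a.2) ^ 2 ≤ 8 * Real.pi ^ 2 * η.2.2 ^ 2 + 2 * a.2 ^ 2 := by
      nlinarith [sq_nonneg (2 * Real.pi * η.2.2 - a.2)]
    have e3 : 0 ≤ 8 * Real.pi ^ 2 + (1 + 2 * (a.1 ^ 2 + a.2 ^ 2)) * (η.2.1 ^ 2 + η.2.2 ^ 2) := by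
      positivity
    rw [hK]
    linarith
  rw [norm_mul, Complex.norm_real, Real.norm_of_nonneg (by positivity)]
  calc _ ≤ (σ * (√|σ - τ| * √|2 * Real.pi * η.1|))⁻¹
        * ((1 + η.1 ^ 2)⁻¹ * (K * (1 + σ ^ 2)⁻¹)) := by gcongr
    _ = _ := by
      rw [abs_mul, abs_of_pos Real.two_pi_pos, Real.sqrt_mul (by positivity), sub_zero]
      simp only [mul_inv]
      ring

/-! ### Adapted frames and the kernel on three-space -/

/-- The coordinates with respect to an orthonormal basis, with the first one split off. -/
def coords (v : OrthonormalBasis (Fin 3) ℝ E3) : E3 ≃ᵐ ℝ × ℝ × ℝ :=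
  ((v.measurableEquiv.trans (MeasurableEquiv.toLp 2 (Fin 3 → ℝ)).symm).trans
    (MeasurableEquiv.piFinSuccAbove (fun _ => ℝ) 0)).trans
      ((MeasurableEquiv.refl ℝ).prodCongr MeasurableEquiv.finTwoArrow)

lemma coords_apply (v : OrthonormalBasis (Fin 3) ℝ E3) (x : E3) :
    coords v x = (inner ℝ (v 0) x, inner ℝ (v 1) x, inner ℝ (v 2) x) := by
  simp only [← v.repr_apply_apply]
  rfl

lemma measurePreserving_coords (v : OrthonormalBasis (Fin 3) ℝ E3) :
    MeasurePreserving (coords v) volume volume :=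
  ((v.measurePreserving_measurableEquiv.trans
    (EuclideanSpace.volume_preserving_symm_measurableEquiv_toLp (Fin 3))).trans
    (volume_preserving_piFinSuccAbove (fun _ => ℝ) 0)).trans
      ((MeasurePreserving.id volume).prod (volume_preserving_finTwoArrow ℝ))

lemma inner_eq_coords (v : OrthonormalBasis (Fin 3) ℝ E3) (x y : E3) :
    inner ℝ x y = (coords v x).1 * (coords v y).1 + ((coords v x).2.1 * (coords v y).2.1
      + (coords v x).2.2 * (coords v y).2.2) := by
  rw [← v.sum_inner_mul_inner x y, Fin.sum_univ_three, coords_apply, coords_apply]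
  simp only [real_inner_comm]
  ring

lemma norm_sq_eq_coords (v : OrthonormalBasis (Fin 3) ℝ E3) (x : E3) :
    ‖x‖ ^ 2 = (coords v x).1 ^ 2 + ((coords v x).2.1 ^ 2 + (coords v x).2.2 ^ 2) := by
  rw [← real_inner_self_eq_norm_sq, inner_eq_coords v]
  ring

lemma norm_eq_coordNorm (v : OrthonormalBasis (Fin 3) ℝ E3) (x : E3) :
    ‖x‖ = coordNorm (coords v x) := by
  rw [coordNorm, ← norm_sq_eq_coords, Real.sqrt_sq (norm_nonneg x)]

lemma exists_orthonormalBasis_smul_eq (b : E3) :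
    ∃ v : OrthonormalBasis (Fin 3) ℝ E3, b = ‖b‖ • v 0 := by
  by_cases hb : b = 0
  · exact ⟨EuclideanSpace.basisFun (Fin 3) ℝ, by simp [hb]⟩
  · have hb' : ‖b‖ ≠ 0 := norm_ne_zero_iff.2 hb
    obtain ⟨v, hv⟩ := Orthonormal.exists_orthonormalBasis_extension_of_card_eq (𝕜 := ℝ) (E := E3)
      (ι := Fin 3) (by simp) (v := fun _ => ‖b‖⁻¹ • b) (s := {0}) (by
        constructor
        · intro i
          simp [Set.domRestrict, norm_smul, hb']
        · intro i j hij
          exact absurd (Subsingleton.elim i j) hij)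
    refine ⟨v, ?_⟩
    rw [hv 0 rfl, smul_smul, mul_inv_cancel₀ hb', one_smul]

/-- Every complex frequency with `z · z = 0` has real and imaginary parts that are orthogonal and of
equal length; in an orthonormal frame whose first vector points along `Im z`, the symbol takes the
form `coordSymbol`. -/
lemma exists_frame (z : Fin 3 → ℂ) (hz : z ⬝ᵥ z = 0) :
    ∃ (v : OrthonormalBasis (Fin 3) ℝ E3) (τ : ℝ) (a : ℝ × ℝ), 0 ≤ τ ∧
      ∀ η : E3, symbol z ((2 * Real.pi) • η) = coordSymbol τ a (coords v η) := by
  set A : E3 := WithLp.toLp 2 fun j => (z j).re with hA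
  set B : E3 := WithLp.toLp 2 fun j => (z j).im with hB
  have hre : ‖A‖ ^ 2 - ‖B‖ ^ 2 = 0 := by
    have := congrArg Complex.re hz
    simp only [dotProduct, Complex.re_sum, Complex.mul_re, Complex.zero_re] at this
    rw [EuclideanSpace.real_norm_sq_eq, EuclideanSpace.real_norm_sq_eq, ← Finset.sum_sub_distrib,
      ← this]
    exact Finset.sum_congr rfl fun j _ => by simp [hA, hB, sq]
  have him : inner ℝ A B = 0 := by
    have := congrArg Complex.im hz
    simp only [dotProduct, Complex.im_sum, Complex.mul_im, Complex.zero_im] at this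
    have h2 : inner ℝ A B = (∑ j, ((z j).re * (z j).im + (z j).im * (z j).re)) / 2 := by
      rw [PiLp.inner_apply, Finset.sum_div]
      exact Finset.sum_congr rfl fun j _ => by simp [hA, hB]; ring
    rw [h2, this, zero_div]
  obtain ⟨v, hv⟩ := exists_orthonormalBasis_smul_eq B
  have hA0 : ‖B‖ * (coords v A).1 = 0 := by
    rw [coords_apply]
    rw [hv, inner_smul_right, real_inner_comm] at him
    exact him
  have hA0' : (coords v A).1 = 0 := by
    rcases mul_eq_zero.1 hA0 with h | h
    · have : ‖A‖ ^ 2 = 0 := by rw [h] at hre; linarith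
      have : A = 0 := by simpa using this
      rw [coords_apply, this]; simp
    · exact h
  have hAsq := norm_sq_eq_coords v A
  rw [hA0'] at hAsq
  refine ⟨v, ‖B‖, (coords v A).2, norm_nonneg _, fun η => ?_⟩
  have hsum : ∑ j, z j * ((((2 * Real.pi) • η : E3) j : ℝ) : ℂ)
      = ((2 * Real.pi * inner ℝ A η : ℝ) : ℂ) + Complex.I * ((2 * Real.pi * inner ℝ B η : ℝ) : ℂ) := by
    rw [PiLp.inner_apply, PiLp.inner_apply]
    push_cast
    rw [Finset.mul_sum, Finset.mul_sum, Finset.mul_sum, ← Finset.sum_add_distrib]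
    refine Finset.sum_congr rfl fun j _ => ?_
    simp only [hA, hB, PiLp.smul_apply, smul_eq_mul, RCLike.inner_apply, conj_trivial]
    push_cast
    have hzj : z j = (z j).re + (z j).im * Complex.I := (Complex.re_add_im _).symm
    linear_combination 2 * (Real.pi : ℂ) * (η j : ℂ) * hzj
  have hB1 : inner ℝ B η = ‖B‖ * (coords v η).1 := by
    rw [coords_apply]
    conv_lhs => rw [hv]
    rw [inner_smul_left]; rfl
  have hA1 := inner_eq_coords v A η
  rw [hA0', zero_mul, zero_add] at hA1
  have hη := norm_sq_eq_coords v η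
  rw [symbol, hsum, hB1, hA1, norm_smul, mul_pow, hη, coordSymbol, radialSymbol]
  rw [← Complex.ofReal_pow (planeNorm _), planeNorm, Real.sq_sqrt (by positivity), Real.norm_eq_abs,
    sq_abs]
  simp only [transFreq, Prod.fst_add, Prod.snd_add, Prod.smul_fst, Prod.smul_snd, smul_eq_mul]
  have hAB : ((‖B‖ : ℝ) : ℂ) ^ 2 = ((coords v A).2.1 : ℂ) ^ 2 + ((coords v A).2.2 : ℂ) ^ 2 := by
    have : ‖B‖ ^ 2 = (coords v A).2.1 ^ 2 + (coords v A).2.2 ^ 2 := by linarith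
    exact_mod_cast this
  push_cast
  linear_combination hAB - (‖B‖ : ℂ) ^ 2 * Complex.I_sq

/-- The weight `1 / |x|` is integrable at the origin. -/
lemma lintegral_indicator_inv_enorm_lt_top :
    ∫⁻ x : E3, Set.indicator (Metric.ball (0 : E3) 1) (fun x => ‖x‖ₑ⁻¹) x < ∞ := by
  have h : IntegrableOn (fun x : E3 => ‖x‖⁻¹) (Metric.ball 0 1) :=
    integrableOn_ball_of_norm_le_rpow (C := 1) (α := 1) (by simp) (by simp)
      (Eventually.of_forall fun x => by rw [one_mul, Real.rpow_neg_one, norm_inv, norm_norm])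
      (by fun_prop)
  rw [lintegral_indicator Metric.isOpen_ball.measurableSet]
  refine lt_of_le_of_lt (lintegral_mono_ae ?_) h.2
  have h0 : ∀ᵐ x : E3, x ≠ 0 := by simp [ae_iff]
  filter_upwards [ae_restrict_of_ae h0] with x hx
  rw [enorm_inv (norm_ne_zero_iff.2 hx), enorm_norm]

/-- The Newtonian potential of a bounded integrable function is bounded. -/
lemma exists_lintegral_enorm_div_le {h : E3 → ℂ} (hh : Integrable h) {M : ℝ}
    (hM : ∀ x, ‖h x‖ ≤ M) :
    ∃ B : ℝ≥0∞, B < ∞ ∧ ∀ y : E3, ∫⁻ x, ‖h x‖ₑ / ‖x - y‖ₑ ≤ B := by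
  refine ⟨ENNReal.ofReal M * (∫⁻ x : E3, Set.indicator (Metric.ball (0 : E3) 1)
    (fun x => ‖x‖ₑ⁻¹) x) + ∫⁻ x, ‖h x‖ₑ, ENNReal.add_lt_top.2
      ⟨ENNReal.mul_lt_top ENNReal.ofReal_lt_top lintegral_indicator_inv_enorm_lt_top, hh.2⟩,
      fun y => ?_⟩
  have hm : Measurable (Set.indicator (Metric.ball (0 : E3) 1) (fun x : E3 => ‖x‖ₑ⁻¹)) :=
    Measurable.indicator (by fun_prop) Metric.isOpen_ball.measurableSet
  rw [← lintegral_sub_right_eq_self (Set.indicator (Metric.ball (0 : E3) 1)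
    (fun x : E3 => ‖x‖ₑ⁻¹)) y, ← lintegral_const_mul _ (by fun_prop),
    ← lintegral_add_left (by fun_prop)]
  refine lintegral_mono fun x => ?_
  by_cases hx : x - y ∈ Metric.ball (0 : E3) 1
  · rw [Set.indicator_of_mem hx, div_eq_mul_inv]
    refine le_add_right ?_
    gcongr
    rw [← ofReal_norm]
    exact ENNReal.ofReal_le_ofReal (hM x)
  · rw [Set.indicator_of_notMem hx, mul_zero, zero_add]
    refine ENNReal.div_le_of_le_mul ?_
    have h1 : 1 ≤ ‖x - y‖ₑ := by
      rw [← ofReal_norm, ENNReal.one_le_ofReal]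
      simpa using hx
    exact le_mul_of_one_le_right zero_le h1

lemma exists_norm_schwartz_le (φ : 𝓢(E3, ℂ)) : ∃ M : ℝ, ∀ x, ‖φ x‖ ≤ M := by
  obtain ⟨C, -, hC⟩ := φ.decay 0 0
  exact ⟨C, fun x => by simpa using hC x⟩

lemma exists_norm_schwartz_mul_le (φ : 𝓢(E3, ℂ)) :
    ∃ M : ℝ, ∀ x, ‖φ x‖ * (1 + ‖x‖ ^ 2) ^ 2 ≤ M := by
  obtain ⟨C, -, hC⟩ := φ.decay 0 0
  obtain ⟨C', -, hC'⟩ := φ.decay 4 0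
  refine ⟨2 * C + 2 * C', fun x => ?_⟩
  have h1 : ‖φ x‖ ≤ C := by simpa using hC x
  have h2 : ‖x‖ ^ 4 * ‖φ x‖ ≤ C' := by simpa using hC' x
  have h3 : (1 + ‖x‖ ^ 2) ^ 2 ≤ 2 + 2 * ‖x‖ ^ 4 := by nlinarith [sq_nonneg (‖x‖ ^ 2 - 1)]
  nlinarith [norm_nonneg (φ x), mul_le_mul_of_nonneg_left h3 (norm_nonneg (φ x))]

lemma continuous_symbol (z : Fin 3 → ℂ) : Continuous (symbol z) := by
  unfold symbol
  fun_prop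

/-- The inverse of the symbol is integrable against Schwartz functions. -/
lemma integrable_inv_symbol_mul (z : Fin 3 → ℂ) (hz : z ⬝ᵥ z = 0) (φ : 𝓢(E3, ℂ)) :
    Integrable (fun η : E3 => (symbol z ((2 * Real.pi) • η))⁻¹ * φ η) := by
  obtain ⟨v, τ, a, hτ, hs⟩ := exists_frame z hz
  obtain ⟨M, hM⟩ := exists_norm_schwartz_mul_le φ
  have h0 := ((measurePreserving_coords v).integrable_comp_emb
    (coords v).measurableEmbedding).2 (integrable_inv_coordSymbol_mul hτ a)
  refine (h0.norm.const_mul M).mono' ?_ (Eventually.of_forall fun η => ?_)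
  · exact (((continuous_symbol z).measurable.comp (by fun_prop)).inv.mul
      φ.continuous.measurable).aestronglyMeasurable
  · simp only [Function.comp]
    rw [norm_mul, norm_mul, hs, Complex.norm_real, Real.norm_of_nonneg (by positivity),
      mul_left_comm]
    refine mul_le_mul_of_nonneg_left ?_ (norm_nonneg _)
    rw [← mul_inv, ← div_eq_mul_inv, le_div_iff₀ (by positivity)]
    refine le_trans (mul_le_mul_of_nonneg_left ?_ (norm_nonneg _)) (hM η)
    have h1 := norm_sq_eq_coords v η
    have h2 : planeNorm (coords v η).2 ^ 2 = (coords v η).2.1 ^ 2 + (coords v η).2.2 ^ 2 :=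
      Real.sq_sqrt (by positivity)
    rw [h2, sq (1 + ‖η‖ ^ 2), h1]
    have h3 := sq_nonneg (coords v η).1
    have h4 := sq_nonneg (coords v η).2.1
    have h5 := sq_nonneg (coords v η).2.2
    exact mul_le_mul (by linarith) (by linarith) (by positivity) (by positivity)

/-- The kernel of the inverse of the symbol: existence, uniform bound and pairing identity. -/
lemma exists_kernel (z : Fin 3 → ℂ) (hz : z ⬝ᵥ z = 0) :
    ∃ k : E3 → ℂ, Measurable k ∧ (∀ x, ‖k x‖ₑ ≤ ENNReal.ofReal 4 / ‖x‖ₑ) ∧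
      ∀ (φ : 𝓢(E3, ℂ)) (y : E3),
        ∫ η, (symbol z ((2 * Real.pi) • η))⁻¹ *
          (Complex.exp (((-2 * Real.pi * inner ℝ y η : ℝ) : ℂ) * Complex.I)
            * (𝓕⁻ φ : 𝓢(E3, ℂ)) η) = ∫ x, φ x * k (x - y) := by
  obtain ⟨v, τ, a, hτ, hs⟩ := exists_frame z hz
  have hmp := measurePreserving_coords v
  refine ⟨fun x => coordKernel τ a (coords v x),
    (measurable_coordKernel τ a).comp (coords v).measurable, fun x => ?_, fun φ y => ?_⟩
  · have h1 : ‖coordKernel τ a (coords v x)‖ * ‖x‖ ≤ 4 := by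
      have h2 := norm_radialKernel_mul_le hτ (coords v x)
      rw [coordKernel, norm_mul, norm_mul, norm_exp_I_mul, one_mul, Complex.norm_real,
        Real.norm_of_nonneg (by positivity), norm_eq_coordNorm v, mul_assoc]
      have hpi := Real.pi_gt_three
      calc _ ≤ ((2 * Real.pi) ^ 2)⁻¹ * (38 * Real.pi) := by gcongr
        _ = 38 / (4 * Real.pi) := by field_simp; norm_num
        _ ≤ 4 := by rw [div_le_iff₀ (by positivity)]; linarith
    -- At the origin the right-hand side is `4 / 0 = ∞`.
    rcases eq_or_ne x 0 with rfl | hx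
    · simp [ENNReal.div_zero]
    · rw [ENNReal.le_div_iff_mul_le (by simp [hx]) (by simp), ← ofReal_norm, ← ofReal_norm,
        ← ENNReal.ofReal_mul (norm_nonneg _)]
      exact ENNReal.ofReal_le_ofReal h1
  · set φ₀ : ℝ × ℝ × ℝ → ℂ := fun x => φ ((coords v).symm x + y) with hφ₀
    have hφ₀c : ∀ x, φ₀ (coords v x) = φ (x + y) := fun x => by simp [hφ₀]
    have hwave : ∀ η : E3, ∫ x, coordWave x (coords v η) * φ₀ x
        = Complex.exp (((-2 * Real.pi * inner ℝ y η : ℝ) : ℂ) * Complex.I)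
            * (𝓕⁻ φ : 𝓢(E3, ℂ)) η := by
      intro η
      rw [← hmp.integral_comp' (g := fun x => coordWave x (coords v η) * φ₀ x)]
      simp only [hφ₀c]
      rw [← integral_sub_right_eq_self _ y, SchwartzMap.fourierInv_coe, Real.fourierInv_eq',
        ← integral_const_mul]
      congr 1; ext x
      rw [sub_add_cancel, smul_eq_mul, ← mul_assoc, ← Complex.exp_add, coordWave,
        ← inner_eq_coords, inner_sub_left]
      congr 2
      push_cast
      ring
    have hφint : Integrable (fun x : E3 => φ (x + y)) := φ.integrable.comp_add_right y
    have hI1 : Integrable φ₀ := by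
      rw [← hmp.integrable_comp_emb (coords v).measurableEmbedding]
      simpa only [Function.comp_def, hφ₀c] using hφint
    have hI2 : Integrable (fun x => ‖φ₀ x‖ * (coordNorm x)⁻¹) := by
      rw [← hmp.integrable_comp_emb (coords v).measurableEmbedding]
      simp only [Function.comp_def, hφ₀c, ← norm_eq_coordNorm]
      obtain ⟨M, hM⟩ := exists_norm_schwartz_le φ
      obtain ⟨B, hB, hB'⟩ := exists_lintegral_enorm_div_le hφint (fun x => hM (x + y))
      refine ⟨hφint.norm.aestronglyMeasurable.mul (by fun_prop), lt_of_le_of_lt ?_ hB⟩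
      refine (lintegral_mono_ae ?_).trans (hB' 0)
      have h0 : ∀ᵐ x : E3, x ≠ 0 := by simp [ae_iff]
      filter_upwards [h0] with x hx
      rw [enorm_mul, enorm_norm, enorm_inv (norm_ne_zero_iff.2 hx), enorm_norm, sub_zero,
        div_eq_mul_inv]
    have hI3 : Integrable (fun η => (coordSymbol τ a η)⁻¹ * ∫ x, coordWave x η * φ₀ x) := by
      rw [← hmp.integrable_comp_emb (coords v).measurableEmbedding]
      simp only [Function.comp_def, hwave, ← hs]
      have := (integrable_inv_symbol_mul z hz (𝓕⁻ φ)).bdd_mul (c := 1)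
        (f := fun η => Complex.exp (((-2 * Real.pi * inner ℝ y η : ℝ) : ℂ) * Complex.I))
        (Continuous.aestronglyMeasurable (by fun_prop))
        (Eventually.of_forall fun η => (Complex.norm_exp_ofReal_mul_I _).le)
      refine this.congr (Eventually.of_forall fun η => ?_)
      ring
    have key := integral_inv_coordSymbol_mul_eq hτ a hI1 hI2 hI3
    rw [← hmp.integral_comp' (g := fun η => (coordSymbol τ a η)⁻¹ * ∫ x, coordWave x η * φ₀ x),
      ← hmp.integral_comp' (g := fun x => φ₀ x * coordKernel τ a x)] at key
    simp only [hwave, ← hs, hφ₀c] at key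
    rw [key, ← integral_sub_right_eq_self _ y]
    simp only [sub_add_cancel]

/-! ### Convolution with the kernel and the weighted estimate -/

/-- The Newtonian potential of `|u|`, up to a constant. -/
def newtonPotential (u : E3 → ℂ) (x : E3) : ℝ≥0∞ := ∫⁻ y, ‖u y‖ₑ / ‖x - y‖ₑ

/-- Tonelli's theorem for the Newtonian potential: it is symmetric. -/
lemma lintegral_mul_newtonPotential {h : E3 → ℝ≥0∞} (hh : AEMeasurable h) {u : E3 → ℂ}
    (hu : AEStronglyMeasurable u) :
    ∫⁻ x, h x * newtonPotential u x = ∫⁻ y, ‖u y‖ₑ * ∫⁻ x, h x / ‖x - y‖ₑ := by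
  unfold newtonPotential
  have hm : AEMeasurable (Function.uncurry fun (x y : E3) => h x * (‖u y‖ₑ / ‖x - y‖ₑ))
      (volume.prod volume) := by
    simp only [div_eq_mul_inv]
    exact hh.comp_fst.mul (hu.enorm.comp_snd.mul (by fun_prop))
  have hinv : ∀ y : E3, AEMeasurable (fun x : E3 => ‖x - y‖ₑ⁻¹) := fun y => by fun_prop
  have hinv' : ∀ x : E3, AEMeasurable (fun y : E3 => ‖x - y‖ₑ⁻¹) := fun y => by fun_prop
  calc _ = ∫⁻ x, ∫⁻ y, h x * (‖u y‖ₑ / ‖x - y‖ₑ) := by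
        refine lintegral_congr fun x => ?_
        rw [lintegral_const_mul'']
        simp only [div_eq_mul_inv]
        exact hu.enorm.mul (hinv' x)
    _ = ∫⁻ y, ∫⁻ x, h x * (‖u y‖ₑ / ‖x - y‖ₑ) := lintegral_lintegral_swap hm
    _ = _ := by
        refine lintegral_congr fun y => ?_
        rw [← lintegral_const_mul'']
        · refine lintegral_congr fun x => ?_
          simp only [div_eq_mul_inv]
          ring
        · simp only [div_eq_mul_inv]
          exact hh.mul (hinv y)

lemma lintegral_enorm_mul_newtonPotential_lt_top {h u : E3 → ℂ} (hh : Integrable h) {M : ℝ}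
    (hM : ∀ x, ‖h x‖ ≤ M) (hu : Integrable u) :
    ∫⁻ x, ‖h x‖ₑ * newtonPotential u x < ∞ := by
  obtain ⟨B, hB, hB'⟩ := exists_lintegral_enorm_div_le hh hM
  rw [lintegral_mul_newtonPotential hh.aestronglyMeasurable.enorm hu.aestronglyMeasurable]
  calc _ ≤ ∫⁻ y, ‖u y‖ₑ * B := lintegral_mono fun y => by gcongr; exact hB' y
    _ = (∫⁻ y, ‖u y‖ₑ) * B := lintegral_mul_const' _ _ hB.ne
    _ < ∞ := ENNReal.mul_lt_top hu.2 hB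

section Convolution

variable {k u : E3 → ℂ} {c : ℝ≥0∞}

lemma enorm_integral_kernel_le (hc : c ≠ ∞) (hkc : ∀ x, ‖k x‖ₑ ≤ c / ‖x‖ₑ) (x : E3) :
    ‖∫ y, k (x - y) * u y‖ₑ ≤ c * newtonPotential u x := by
  refine (enorm_integral_le_lintegral_enorm _).trans ?_
  rw [newtonPotential, ← lintegral_const_mul' _ _ hc]
  refine lintegral_mono fun y => ?_
  rw [enorm_mul]
  calc _ ≤ c / ‖x - y‖ₑ * ‖u y‖ₑ := by gcongr; exact hkc _
    _ = _ := by simp only [div_eq_mul_inv]; ring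

lemma aestronglyMeasurable_kernel_mul (hk : Measurable k) (hu : Integrable u) :
    AEStronglyMeasurable (fun z : E3 × E3 => k (z.1 - z.2) * u z.2) (volume.prod volume) :=
  (hk.comp (by fun_prop : Measurable fun z : E3 × E3 => z.1 - z.2)).aestronglyMeasurable.mul
    hu.aestronglyMeasurable.comp_snd

lemma aestronglyMeasurable_integral_kernel (hk : Measurable k) (hu : Integrable u) :
    AEStronglyMeasurable (fun x => ∫ y, k (x - y) * u y) :=
  (aestronglyMeasurable_kernel_mul hk hu).integral_prod_right'

lemma integrable_mul_integral_kernel (hk : Measurable k) (hc : c ≠ ∞)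
    (hkc : ∀ x, ‖k x‖ₑ ≤ c / ‖x‖ₑ) (hu : Integrable u) {h : E3 → ℂ} (hh : Integrable h) {M : ℝ}
    (hM : ∀ x, ‖h x‖ ≤ M) : Integrable (fun x => (∫ y, k (x - y) * u y) * h x) := by
  refine ⟨(aestronglyMeasurable_integral_kernel hk hu).mul hh.aestronglyMeasurable, ?_⟩
  refine lt_of_le_of_lt (lintegral_mono (g := fun x => c * (‖h x‖ₑ * newtonPotential u x))
    fun x => ?_) ?_
  · rw [enorm_mul]
    calc _ ≤ c * newtonPotential u x * ‖h x‖ₑ := by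
          gcongr; exact enorm_integral_kernel_le hc hkc x
      _ = _ := by ring
  · rw [lintegral_const_mul' _ _ hc]
    exact ENNReal.mul_lt_top hc.lt_top (lintegral_enorm_mul_newtonPotential_lt_top hh hM hu)

lemma locallyIntegrable_integral_kernel (hk : Measurable k) (hc : c ≠ ∞)
    (hkc : ∀ x, ‖k x‖ₑ ≤ c / ‖x‖ₑ) (hu : Integrable u) :
    LocallyIntegrable (fun x => ∫ y, k (x - y) * u y) := by
  rw [locallyIntegrable_iff]
  intro K hK
  have hKm := hK.isClosed.measurableSet
  have h1 : Integrable (Set.indicator K fun _ : E3 => (1 : ℂ)) := by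
    rw [integrable_indicator_iff hKm]
    exact integrableOn_const (hs := hK.measure_lt_top.ne)
  have h2 := integrable_mul_integral_kernel hk hc hkc hu h1 (M := 1) fun x =>
    (norm_indicator_le_norm_self _ _).trans (by simp)
  rw [← integrable_indicator_iff hKm]
  refine h2.congr (Eventually.of_forall fun x => ?_)
  by_cases hx : x ∈ K <;> simp [hx]

/-- Fubini's theorem for the pairing of `k * u` with a bounded integrable function. -/
lemma integral_mul_integral_kernel (hk : Measurable k) (hc : c ≠ ∞)
    (hkc : ∀ x, ‖k x‖ₑ ≤ c / ‖x‖ₑ) (hu : Integrable u) {h : E3 → ℂ} (hh : Integrable h) {M : ℝ}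
    (hM : ∀ x, ‖h x‖ ≤ M) :
    ∫ x, (∫ y, k (x - y) * u y) * h x = ∫ y, u y * ∫ x, h x * k (x - y) := by
  have hm : AEStronglyMeasurable (fun z : E3 × E3 => k (z.1 - z.2) * u z.2 * h z.1)
      (volume.prod volume) :=
    (aestronglyMeasurable_kernel_mul hk hu).mul hh.aestronglyMeasurable.comp_fst
  have hint : Integrable (Function.uncurry fun (x y : E3) => k (x - y) * u y * h x)
      (volume.prod volume) := by
    refine ⟨hm, ?_⟩
    have hprod := lintegral_prod _ hm.enorm
    refine lt_of_eq_of_lt hprod ?_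
    refine lt_of_le_of_lt (lintegral_mono (g := fun x => c * (‖h x‖ₑ * newtonPotential u x))
      fun x => ?_) ?_
    · beta_reduce
      rw [newtonPotential, ← mul_assoc, ← lintegral_const_mul' _ _ (ENNReal.mul_ne_top hc
        enorm_ne_top)]
      refine lintegral_mono fun y => ?_
      simp only [enorm_mul]
      calc _ ≤ c / ‖x - y‖ₑ * ‖u y‖ₑ * ‖h x‖ₑ := by gcongr; exact hkc _
        _ = _ := by simp only [div_eq_mul_inv]; ring
    · rw [lintegral_const_mul' _ _ hc]
      exact ENNReal.mul_lt_top hc.lt_top (lintegral_enorm_mul_newtonPotential_lt_top hh hM hu)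
  simp only [← integral_mul_const, ← integral_const_mul]
  rw [integral_integral_swap hint]
  congr 1; ext y; congr 1; ext x
  ring

end Convolution

/-- Convolution with a kernel that represents the inverse of the symbol is the operator `G_z`. -/
lemma isGreen_integral_kernel {z : Fin 3 → ℂ} (hz : z ⬝ᵥ z = 0) {k u : E3 → ℂ}
    (hk : Measurable k) {c : ℝ≥0∞} (hc : c ≠ ∞) (hkc : ∀ x, ‖k x‖ₑ ≤ c / ‖x‖ₑ)
    (hpair : ∀ (φ : 𝓢(E3, ℂ)) (y : E3),
        ∫ η, (symbol z ((2 * Real.pi) • η))⁻¹ *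
          (Complex.exp (((-2 * Real.pi * inner ℝ y η : ℝ) : ℂ) * Complex.I)
            * (𝓕⁻ φ : 𝓢(E3, ℂ)) η) = ∫ x, φ x * k (x - y))
    (hu : Integrable u) : IsGreen z u (fun x => ∫ y, k (x - y) * u y) := by
  refine ⟨hu, fun φ => ?_, locallyIntegrable_integral_kernel hk hc hkc hu, fun φ => ?_, fun φ => ?_⟩
  · have h1 : Continuous (𝓕 u) := VectorFourier.fourierIntegral_continuous
      Real.continuous_fourierChar (by exact continuous_inner) hu
    refine ((integrable_inv_symbol_mul z hz (𝓕⁻ φ)).bdd_mul (c := ∫ x, ‖u x‖)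
      h1.aestronglyMeasurable (Eventually.of_forall fun η =>
        VectorFourier.norm_fourierIntegral_le_integral_norm _ _ _ _ _)).congr
      (Eventually.of_forall fun η => ?_)
    simp only [pairingIntegrand]
    ring
  · obtain ⟨M, hM⟩ := exists_norm_schwartz_le φ
    exact integrable_mul_integral_kernel hk hc hkc hu φ.integrable hM
  · obtain ⟨M, hM⟩ := exists_norm_schwartz_le φ
    rw [integral_mul_integral_kernel hk hc hkc hu φ.integrable hM]
    simp only [← hpair φ]
    have hint : Integrable (Function.uncurry fun (y η : E3) =>
        Complex.exp (((-2 * Real.pi * inner ℝ y η : ℝ) : ℂ) * Complex.I) *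
          (u y * ((symbol z ((2 * Real.pi) • η))⁻¹ * (𝓕⁻ φ : 𝓢(E3, ℂ)) η)))
        (volume.prod volume) := by
      refine (hu.mul_prod (integrable_inv_symbol_mul z hz (𝓕⁻ φ))).bdd_mul (c := 1)
        (Continuous.aestronglyMeasurable (by fun_prop))
        (Eventually.of_forall fun η => (Complex.norm_exp_ofReal_mul_I _).le)
    have hswap := integral_integral_swap hint
    calc _ = ∫ y, ∫ η, Complex.exp (((-2 * Real.pi * inner ℝ y η : ℝ) : ℂ) * Complex.I) *
          (u y * ((symbol z ((2 * Real.pi) • η))⁻¹ * (𝓕⁻ φ : 𝓢(E3, ℂ)) η)) := by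
          simp only [← integral_const_mul]
          congr 1; ext y; congr 1; ext η
          ring
      _ = _ := hswap
      _ = _ := by
          congr 1; ext η
          rw [pairingIntegrand, Real.fourier_eq', mul_assoc, mul_left_comm, ← integral_mul_const]
          congr 1; ext y
          rw [smul_eq_mul]
          ring_nf

lemma enorm_sqrtAbs_sq (V : E3 → ℂ) (x : E3) : ‖sqrtAbs V x‖ₑ ^ 2 = ‖V x‖ₑ := by
  rw [sqrtAbs, ← ofReal_norm, ← ofReal_norm, Complex.norm_real,
    Real.norm_of_nonneg (Real.sqrt_nonneg _), ← ENNReal.ofReal_pow (Real.sqrt_nonneg _),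
    Real.sq_sqrt (norm_nonneg _)]

lemma aestronglyMeasurable_sqrtAbs {V : E3 → ℂ} (hV : AEStronglyMeasurable V) :
    AEStronglyMeasurable (sqrtAbs V) :=
  Complex.continuous_ofReal.comp_aestronglyMeasurable
    (Real.continuous_sqrt.comp_aestronglyMeasurable hV.norm)

lemma memLp_two_sqrtAbs {V : E3 → ℂ} (hV : Integrable V) : MemLp (sqrtAbs V) 2 := by
  have hm := aestronglyMeasurable_sqrtAbs hV.aestronglyMeasurable
  rw [memLp_two_iff_integrable_sq_norm hm]
  refine hV.norm.congr (Eventually.of_forall fun x => ?_)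
  simp only [sqrtAbs]
  rw [Complex.norm_real, Real.norm_of_nonneg (Real.sqrt_nonneg _), Real.sq_sqrt (norm_nonneg _)]

/-- The Cauchy-Schwarz inequality with respect to the weight `1 / |x - y|`. -/
lemma newtonPotential_sq_le {W f : E3 → ℂ} (hW : AEStronglyMeasurable W)
    (hf : AEStronglyMeasurable f) (x : E3) :
    newtonPotential (fun y => sqrtAbs W y * f y) x ^ 2
      ≤ eKatoNorm W * ∫⁻ y, ‖f y‖ₑ ^ 2 / ‖x - y‖ₑ := by
  set r : E3 → ℝ≥0∞ := fun y => (‖x - y‖ₑ⁻¹) ^ (1 / 2 : ℝ) with hr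
  have hr2 : ∀ y, r y ^ 2 = ‖x - y‖ₑ⁻¹ := fun y => by
    rw [hr, ← ENNReal.rpow_natCast, ← ENNReal.rpow_mul]; norm_num
  have hrm : AEMeasurable r := by fun_prop
  have hol := ENNReal.lintegral_mul_le_Lp_mul_Lq (volume : Measure E3) Real.HolderConjugate.two_two
    (f := fun y => ‖sqrtAbs W y‖ₑ * r y) (g := fun y => ‖f y‖ₑ * r y)
    ((aestronglyMeasurable_sqrtAbs hW).enorm.mul hrm) (hf.enorm.mul hrm)
  have e1 : newtonPotential (fun y => sqrtAbs W y * f y) x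
      = ∫⁻ y, ((fun y => ‖sqrtAbs W y‖ₑ * r y) * fun y => ‖f y‖ₑ * r y) y := by
    refine lintegral_congr fun y => ?_
    rw [Pi.mul_apply, enorm_mul, div_eq_mul_inv, ← hr2]
    ring
  have e2 : ∀ y, (‖sqrtAbs W y‖ₑ * r y) ^ (2 : ℝ) = ‖W y‖ₑ / ‖x - y‖ₑ := fun y => by
    rw [ENNReal.rpow_two, mul_pow, enorm_sqrtAbs_sq, hr2, div_eq_mul_inv]
  have e3 : ∀ y, (‖f y‖ₑ * r y) ^ (2 : ℝ) = ‖f y‖ₑ ^ 2 / ‖x - y‖ₑ := fun y => by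
    rw [ENNReal.rpow_two, mul_pow, hr2, div_eq_mul_inv]
  rw [← e1] at hol
  simp only [e2, e3] at hol
  have hhalf : ∀ A : ℝ≥0∞, (A ^ (1 / 2 : ℝ)) ^ 2 = A := fun A => by
    rw [← ENNReal.rpow_natCast, ← ENNReal.rpow_mul]; norm_num
  calc _ ≤ _ := pow_le_pow_left' hol 2
    _ = (∫⁻ y, ‖W y‖ₑ / ‖x - y‖ₑ) * ∫⁻ y, ‖f y‖ₑ ^ 2 / ‖x - y‖ₑ := by
        rw [mul_pow, hhalf, hhalf]
    _ ≤ _ := by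
        gcongr
        exact le_iSup (fun x : E3 => ∫⁻ y, ‖W y‖ₑ / ‖x - y‖ₑ) x

/-- The weighted `L²` bound for the Newtonian potential (Schur's test). -/
lemma lintegral_enorm_mul_newtonPotential_sq_le {V W f : E3 → ℂ} (hV : AEStronglyMeasurable V)
    (hW : AEStronglyMeasurable W) (hf : AEStronglyMeasurable f) (hWfin : eKatoNorm W ≠ ∞) :
    ∫⁻ x, ‖V x‖ₑ * newtonPotential (fun y => sqrtAbs W y * f y) x ^ 2
      ≤ eKatoNorm V * eKatoNorm W * ∫⁻ y, ‖f y‖ₑ ^ 2 := by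
  have hinv : ∀ x : E3, AEMeasurable (fun y : E3 => ‖x - y‖ₑ⁻¹) := fun x => by fun_prop
  have hm : AEMeasurable (Function.uncurry fun (x y : E3) => ‖V x‖ₑ * (‖f y‖ₑ ^ 2 / ‖x - y‖ₑ))
      (volume.prod volume) := by
    simp only [div_eq_mul_inv]
    exact hV.enorm.comp_fst.mul ((hf.enorm.comp_snd.pow_const 2).mul (by fun_prop))
  calc _ ≤ ∫⁻ x, eKatoNorm W * ∫⁻ y, ‖V x‖ₑ * (‖f y‖ₑ ^ 2 / ‖x - y‖ₑ) := by
        refine lintegral_mono fun x => ?_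
        rw [lintegral_const_mul' _ _ enorm_ne_top, mul_left_comm]
        gcongr
        exact newtonPotential_sq_le hW hf x
    _ = eKatoNorm W * ∫⁻ y, ∫⁻ x, ‖V x‖ₑ * (‖f y‖ₑ ^ 2 / ‖x - y‖ₑ) := by
        rw [lintegral_const_mul' _ _ hWfin, lintegral_lintegral_swap hm]
    _ ≤ eKatoNorm W * ∫⁻ y, eKatoNorm V * ‖f y‖ₑ ^ 2 := by
        gcongr with y
        calc _ = ∫⁻ x, ‖f y‖ₑ ^ 2 * (‖V x‖ₑ / ‖y - x‖ₑ) := by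
              refine lintegral_congr fun x => ?_
              rw [enorm_sub_rev x y]
              simp only [div_eq_mul_inv]
              ring
          _ = ‖f y‖ₑ ^ 2 * ∫⁻ x, ‖V x‖ₑ / ‖y - x‖ₑ :=
              lintegral_const_mul' _ _ (ENNReal.pow_ne_top enorm_ne_top)
          _ ≤ _ := by
              rw [mul_comm]
              gcongr
              exact le_iSup (fun x : E3 => ∫⁻ y, ‖V y‖ₑ / ‖x - y‖ₑ) y
    _ = _ := by
        rw [lintegral_const_mul'' _ (hf.enorm.pow_const 2)]
        ring

end KatoCGO

end

theorem lemma3p3 :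
    ∃ C : ℝ, 0 < C ∧
      ∀ V W : KatoCGO.E3 → ℂ, KatoCGO.IsKatoCompact V → KatoCGO.IsKatoCompact W →
      ∀ z : Fin 3 → ℂ, z ⬝ᵥ z = 0 →
      ∀ f : KatoCGO.E3 → ℂ, MemLp f 2 volume →
        ∃ g : KatoCGO.E3 → ℂ,
          KatoCGO.IsGreen z (fun y => KatoCGO.sqrtAbs W y * f y) g ∧
          MemLp (fun x => KatoCGO.sqrtAbs V x * g x) 2 volume ∧
          eLpNorm (fun x => KatoCGO.sqrtAbs V x * g x) 2 volume ≤
            ENNReal.ofReal (C * KatoCGO.katoNorm V ^ (1 / 2 : ℝ) * KatoCGO.katoNorm W ^ (1 / 2 : ℝ)) *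
              eLpNorm f 2 volume := by
  refine ⟨4, by norm_num, fun V W hV hW z hz f hf => ?_⟩
  obtain ⟨k, hk, hkc, hpair⟩ := KatoCGO.exists_kernel z hz
  have hu : Integrable (fun y => KatoCGO.sqrtAbs W y * f y) :=
    (KatoCGO.memLp_two_sqrtAbs hW.integrable).integrable_mul hf
  set g : KatoCGO.E3 → ℂ := fun x => ∫ y, k (x - y) * (KatoCGO.sqrtAbs W y * f y)
  have hVfin := hV.eKatoNorm_lt_top.ne
  have hWfin := hW.eKatoNorm_lt_top.ne
  have hsq : ∫⁻ x, ‖KatoCGO.sqrtAbs V x * g x‖ₑ ^ 2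
      ≤ ENNReal.ofReal 4 ^ 2 * (KatoCGO.eKatoNorm V * KatoCGO.eKatoNorm W * ∫⁻ y, ‖f y‖ₑ ^ 2) := by
    refine le_trans (lintegral_mono (g := fun x => ENNReal.ofReal 4 ^ 2 * (‖V x‖ₑ *
      KatoCGO.newtonPotential (fun y => KatoCGO.sqrtAbs W y * f y) x ^ 2)) fun x => ?_) ?_
    · simp only [enorm_mul]
      rw [mul_pow, KatoCGO.enorm_sqrtAbs_sq, mul_left_comm, ← mul_pow]
      gcongr
      exact KatoCGO.enorm_integral_kernel_le ENNReal.ofReal_ne_top hkc x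
    · rw [lintegral_const_mul' _ _ (by simp)]
      gcongr
      exact KatoCGO.lintegral_enorm_mul_newtonPotential_sq_le
        hV.integrable.aestronglyMeasurable hW.integrable.aestronglyMeasurable
        hf.aestronglyMeasurable hWfin
  have hbound : eLpNorm (fun x => KatoCGO.sqrtAbs V x * g x) 2 volume ≤
      ENNReal.ofReal (4 * KatoCGO.katoNorm V ^ (1 / 2 : ℝ) * KatoCGO.katoNorm W ^ (1 / 2 : ℝ)) *
        eLpNorm f 2 volume := by
    rw [eLpNorm_eq_lintegral_rpow_enorm_toReal (by norm_num) (by norm_num),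
      eLpNorm_eq_lintegral_rpow_enorm_toReal (by norm_num) (by norm_num)]
    simp only [ENNReal.toReal_ofNat, ENNReal.rpow_two]
    have hV0 : 0 ≤ KatoCGO.katoNorm V := ENNReal.toReal_nonneg
    have hW0 : 0 ≤ KatoCGO.katoNorm W := ENNReal.toReal_nonneg
    rw [ENNReal.ofReal_mul (by positivity), ENNReal.ofReal_mul (by positivity),
      ← ENNReal.ofReal_rpow_of_nonneg hV0 (by norm_num),
      ← ENNReal.ofReal_rpow_of_nonneg hW0 (by norm_num), KatoCGO.katoNorm, KatoCGO.katoNorm,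
      ENNReal.ofReal_toReal hVfin, ENNReal.ofReal_toReal hWfin]
    refine (ENNReal.rpow_le_rpow hsq (by norm_num)).trans_eq ?_
    rw [ENNReal.mul_rpow_of_nonneg _ _ (by norm_num), ENNReal.mul_rpow_of_nonneg _ _ (by norm_num),
      ENNReal.mul_rpow_of_nonneg _ _ (by norm_num), ← ENNReal.rpow_two, ← ENNReal.rpow_mul]
    norm_num
    ring
  refine ⟨g, KatoCGO.isGreen_integral_kernel hz hk ENNReal.ofReal_ne_top hkc hpair hu,
    ⟨?_, ?_⟩, hbound⟩
  · exact (KatoCGO.aestronglyMeasurable_sqrtAbs hV.integrable.aestronglyMeasurable).mul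
      (KatoCGO.aestronglyMeasurable_integral_kernel hk hu)
  · exact hbound.trans_lt (ENNReal.mul_lt_top ENNReal.ofReal_lt_top hf.2)
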